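/- For a finite graph $\Gamma=(V,E)$ and $X\subseteq V$ let $N(X)$ be the set of vertices in $V\setminus X$ that are adjacent to at least one vertex of $X$, and let $$i_V(\Gamma)=\min\left\{\frac{|N(X)|}{|X|} : \emptyset\ne X\subseteq V,\ |X|\le \frac{|V|}{2}\right\}$$ be the vertex-isoperimetric number of $\Gamma$. For an integer $n\ge 2$ and a prime power $q$ let $\Gamma_{n,q}$ be the point-hyperplane incidence graph of $\mathrm{PG}(n,q)$, that is, the bipartite graph whose two parts are the set of $1$-dimensional subspaces and the set of $n$-dimensional subspaces of $\mathbb{F}_q^{n+1}$, adjacency being containment. Theorem. Let $0<\varepsilon<\frac14$. There is a constant $C>0$ depending only on $\varepsilon$ such that for every integer $n\ge 2$ and every prime power $q=p^e$ ($p$ prime, $e\ge 1$), $$i_V(\Gamma_{n,q})=1-c_{n,q}\,\frac{q^{\frac{n+1}{2}}(q-1)}{q^{n+1}-1}$$ for some real number $c_{n,q}$ with $$\frac12-C\,p^{\varepsilon-\frac14}\le c_{n,q}<1 .$$ -/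

import Mathlib

/-- The vertex-boundary `N(X)`: the vertices outside `X` with at least one neighbour in `X`. -/
def SimpleGraph.vertexBoundary {V : Type*} (G : SimpleGraph V) (X : Set V) : Set V :=
  {v | v ∉ X ∧ ∃ u ∈ X, G.Adj u v}

/-- The values `|N(X)| / |X|` for nonempty `X ⊆ V` with `|X| ≤ |V| / 2`. -/
def SimpleGraph.vertexExpansionRatios {V : Type*} (G : SimpleGraph V) : Set ℝ :=
  {r | ∃ X : Set V, X.Nonempty ∧ (X.ncard : ℝ) ≤ (Nat.card V : ℝ) / 2 ∧
    r = ((G.vertexBoundary X).ncard : ℝ) / (X.ncard : ℝ)}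

/-- The vertex-isoperimetric number `i_V` of a finite graph. For a graph with at least two
vertices it is a minimum, see `SimpleGraph.isLeast_vertexIsoperimetricNumber`. -/
noncomputable def SimpleGraph.vertexIsoperimetricNumber {V : Type*} [Finite V]
    (G : SimpleGraph V) : ℝ :=
  sInf G.vertexExpansionRatios

theorem SimpleGraph.isLeast_vertexIsoperimetricNumber {V : Type*} [Finite V]
    (G : SimpleGraph V) (hV : 2 ≤ Nat.card V) :
    IsLeast G.vertexExpansionRatios G.vertexIsoperimetricNumber := by
  have hfin : G.vertexExpansionRatios.Finite := by
    refine (Set.finite_range fun X : Set V =>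
      ((G.vertexBoundary X).ncard : ℝ) / (X.ncard : ℝ)).subset ?_
    rintro r ⟨X, -, -, rfl⟩
    exact ⟨X, rfl⟩
  have hne : G.vertexExpansionRatios.Nonempty := by
    have : Nonempty V := (Nat.card_pos_iff.mp (by omega)).1
    obtain ⟨v⟩ := this
    refine ⟨_, {v}, Set.singleton_nonempty v, ?_, rfl⟩
    have h2 : (2 : ℝ) ≤ (Nat.card V : ℝ) := by exact_mod_cast hV
    rw [Set.ncard_singleton]
    push_cast
    linarith
  exact ⟨hne.csInf_mem hfin, fun r hr => csInf_le hfin.bddBelow hr⟩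

/-- The points of `PG(n, F)`: the one-dimensional subspaces of `F ^ (n + 1)`. -/
abbrev PGPoint (n : ℕ) (F : Type*) [Field F] : Type _ :=
  {W : Submodule F (Fin (n + 1) → F) // Module.finrank F W = 1}

/-- The hyperplanes of `PG(n, F)`: the `n`-dimensional subspaces of `F ^ (n + 1)`. -/
abbrev PGHyperplane (n : ℕ) (F : Type*) [Field F] : Type _ :=
  {W : Submodule F (Fin (n + 1) → F) // Module.finrank F W = n}

/-- The point-hyperplane incidence graph of `PG(n, F)`: the bipartite graph on the disjoint union
of points and hyperplanes, with a point adjacent to a hyperplane iff it is contained in it. -/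
def pointHyperplaneGraph (n : ℕ) (F : Type*) [Field F] :
    SimpleGraph (PGPoint n F ⊕ PGHyperplane n F) where
  Adj
    | Sum.inl P, Sum.inr H => P.1 ≤ H.1
    | Sum.inr H, Sum.inl P => P.1 ≤ H.1
    | _, _ => False
  symm := ⟨by rintro (P | H) (P' | H') h <;> exact h⟩
  loopless := ⟨by rintro (P | H) h <;> exact h⟩

/-! Write `v` for the number of points and `ρ = q ^ ((n + 1) / 2)`. Since `v * (q - 1) = q ^ (n + 1)
- 1`, the claim says that `1 - i_V = c * ρ / v` with `c` strictly below `1` and at least about `1 /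
2`.

For `c < 1`, let a set contain `a` points and `b` hyperplanes. Cauchy–Schwarz on degrees
(`card_neighbours_lower_bound`) bounds the neighbourhood of each part from below. Neighbours outside
the set are boundary vertices, and what remains is a real inequality in `a` and `b`
(`add_excess_gt_of_add_eq`). It covers every case except the Fano plane, which is a finite check.

For the lower bound on `c`, take `N` points `A` and `N` hyperplanes `T` with no incidence between
them. The set `A ∪ Tᶜ` has exactly `v` vertices, and its boundary lies in the points outside `A`, so
`i_V ≤ 1 - N / v`. It remains to find `N` close to `ρ / 2`. Two extra dimensions cost nothing
(`HasIncidenceFree.add_two`), so only the affine line and the affine plane matter. The line is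
trivial. The plane over `F` reduces to the prime field by looking at top coefficients in a power
basis (`hasIncidenceFree_lift`).

Over the prime field, take primitive integer vectors in the light cone with norm below `√p`. The
form `x₀y₀ + x₁y₁ - x₂y₂` lies strictly between `0` and `p` on them, so it never vanishes mod `p`.
Their density is the volume `2π/3 * (1 - √2/2) ≈ 0.613` divided by `ζ(3) ≈ 1.202`, which slightly
exceeds `1 / 2`. Hence for large `p` the only loss is `1 / p` from rounding, and the constant `C`
absorbs the small primes. -/

/-! ### Double counting in an incidence structure -/

open Finset in
/-- Double counting bound for the neighbourhood of a set in an incidence structure with constant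
degrees and constant codegrees. -/
theorem card_neighbours_lower_bound {α β : Type*} [Fintype β] [DecidableEq α]
    (r : α → β → Prop) [∀ a b, Decidable (r a b)] (k m : ℕ) (A : Finset α)
    (hk : ∀ a ∈ A, #{b | r a b} = k)
    (hm : ∀ a ∈ A, ∀ a' ∈ A, a ≠ a' → #{b | r a b ∧ r a' b} = m) :
    (#A : ℝ) * k ^ 2 ≤ (#{b : β | ∃ a ∈ A, r a b} : ℝ) * ((k - m : ℝ) + #A * m) := by
  set N : Finset β := {b : β | ∃ a ∈ A, r a b} with hN
  set d : β → ℝ := fun b => ∑ a ∈ A, if r a b then 1 else 0 with hd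
  have h0 : ∀ b ∉ N, d b = 0 := by
    intro b hb
    refine Finset.sum_eq_zero fun a ha => ?_
    rw [if_neg]
    intro h
    exact hb (by simp only [hN, mem_filter, mem_univ, true_and]; exact ⟨a, ha, h⟩)
  have h1 : ∑ b ∈ N, d b = #A * k := by
    rw [Finset.sum_subset (Finset.subset_univ N) fun b _ hb => h0 b hb, Finset.sum_comm,
      Finset.sum_congr rfl (g := fun _ => (k : ℝ))]
    · simp
    · intro a ha
      rw [← hk a ha, Finset.sum_boole]
  have h2 : ∑ b ∈ N, d b ^ 2 = #A * ((k - m : ℝ) + #A * m) := by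
    rw [Finset.sum_subset (Finset.subset_univ N) fun b _ hb => by rw [h0 b hb]; simp]
    simp_rw [pow_two, hd, Finset.sum_mul_sum]
    rw [Finset.sum_comm, Finset.sum_congr rfl (g := fun _ => ((k - m : ℝ) + #A * m))]
    · rw [Finset.sum_const, nsmul_eq_mul]
    intro a ha
    rw [Finset.sum_comm, Finset.sum_congr rfl
      (g := fun a' => (if a' = a then (k - m : ℝ) else 0) + m)]
    · rw [Finset.sum_add_distrib, Finset.sum_ite_eq' A a]
      simp [ha]
    intro a' ha'
    have : ∀ b, ((if r a b then (1 : ℝ) else 0) * if r a' b then 1 else 0) =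
        if r a b ∧ r a' b then 1 else 0 := by
      intro b
      split_ifs <;> simp_all
    simp_rw [this, Finset.sum_boole]
    split_ifs with h
    · subst h
      simp only [and_self]
      rw [hk a' ha]; ring
    · rw [hm a ha a' ha' (Ne.symm h)]; ring
  -- Cauchy–Schwarz for the degrees into `A`, which are supported on `N`; their first and second
  -- moments are `h1` and `h2`.
  have h3 := sq_sum_le_card_mul_sum_sq (s := N) (f := d)
  rw [h1, h2] at h3
  rcases A.eq_empty_or_nonempty with h | h
  · simp [h]
    have : (N : Finset β) = ∅ := by simp [hN, h]
    simp [this]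
  have hA : (0 : ℝ) < #A := by exact_mod_cast h.card_pos
  nlinarith [h3]

/-! ### Subspace counts and point-hyperplane duality -/

section Counting

variable {F : Type*} [Field F]

theorem card_points_le [Finite F] (n : ℕ) (W : Submodule F (Fin (n + 1) → F)) :
    Nat.card {P : PGPoint n F // P.1 ≤ W} * (Nat.card F - 1) + 1 =
      Nat.card F ^ Module.finrank F W := by
  have e : {P : PGPoint n F // P.1 ≤ W} ≃ {H : Submodule F W // Module.finrank F H = 1} :=
    { toFun := fun P => ⟨P.1.1.comap W.subtype, by
        rw [(Submodule.comapSubtypeEquivOfLe P.2).finrank_eq]; exact P.1.2⟩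
      invFun := fun H => ⟨⟨H.1.map W.subtype, by
        rw [Submodule.finrank_map_subtype_eq]; exact H.2⟩, Submodule.map_subtype_le _ _⟩
      left_inv := fun P => by
        ext1; ext1
        simp [Submodule.map_comap_subtype, P.2]
      right_inv := fun H => by
        ext1
        simp [Submodule.comap_map_eq_of_injective W.subtype_injective] }
  rw [Nat.card_congr (e.trans (Projectivization.equivSubmodule F W).symm),
    ← Projectivization.card', Module.natCard_eq_pow_finrank (K := F)]

/-- The standard dot product as a bilinear form. -/
noncomputable def dotForm (F : Type*) [Field F] (m : ℕ) : LinearMap.BilinForm F (Fin m → F) :=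
  dotProductBilin F F

theorem dotForm_apply (m : ℕ) (x y : Fin m → F) : dotForm F m x y = x ⬝ᵥ y := rfl

theorem dotForm_isRefl (m : ℕ) : (dotForm F m).IsRefl := by
  intro x y h
  rw [dotForm_apply] at *
  rwa [dotProduct_comm]

theorem dotForm_nondegenerate (m : ℕ) : (dotForm F m).Nondegenerate := by
  constructor
  · intro x hx
    exact dotProduct_eq_zero _ hx
  · intro x hx
    exact dotProduct_eq_zero _ fun w => by rw [dotProduct_comm]; exact hx w

theorem orthogonal_le_iff (m : ℕ) (U W : Submodule F (Fin m → F)) :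
    U ≤ (dotForm F m).orthogonal W ↔ W ≤ (dotForm F m).orthogonal U := by
  have h := LinearMap.BilinForm.orthogonal_orthogonal (dotForm_nondegenerate (F := F) m)
    (dotForm_isRefl m)
  constructor
  · intro hU
    have := LinearMap.BilinForm.orthogonal_le (B := dotForm F m) hU
    rwa [h] at this
  · intro hU
    have := LinearMap.BilinForm.orthogonal_le (B := dotForm F m) hU
    rwa [h] at this

/-- Orthogonal complement exchanges points and hyperplanes. -/
noncomputable def pointEquivHyperplane (n : ℕ) (F : Type*) [Field F] :
    PGPoint n F ≃ PGHyperplane n F where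
  toFun P := ⟨(dotForm F (n + 1)).orthogonal P.1, by
    rw [LinearMap.BilinForm.finrank_orthogonal (dotForm_nondegenerate _), P.2]; simp⟩
  invFun H := ⟨(dotForm F (n + 1)).orthogonal H.1, by
    rw [LinearMap.BilinForm.finrank_orthogonal (dotForm_nondegenerate _), H.2]; simp⟩
  left_inv P := by
    ext1
    exact LinearMap.BilinForm.orthogonal_orthogonal (dotForm_nondegenerate _) (dotForm_isRefl _) _
  right_inv P := by
    ext1
    exact LinearMap.BilinForm.orthogonal_orthogonal (dotForm_nondegenerate _) (dotForm_isRefl _) _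

theorem pointEquivHyperplane_coe (n : ℕ) (P : PGPoint n F) :
    (pointEquivHyperplane n F P).1 = (dotForm F (n + 1)).orthogonal P.1 := rfl

theorem card_hyperplanes_ge [Finite F] (n : ℕ) (W : Submodule F (Fin (n + 1) → F)) :
    Nat.card {H : PGHyperplane n F // W ≤ H.1} * (Nat.card F - 1) + 1 =
      Nat.card F ^ (n + 1 - Module.finrank F W) := by
  have e : {P : PGPoint n F // P.1 ≤ (dotForm F (n + 1)).orthogonal W} ≃
      {H : PGHyperplane n F // W ≤ H.1} :=
    (pointEquivHyperplane n F).subtypeEquiv fun P => by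
      rw [pointEquivHyperplane_coe, orthogonal_le_iff]
  rw [← Nat.card_congr e, card_points_le,
    LinearMap.BilinForm.finrank_orthogonal (dotForm_nondegenerate _)]
  simp

theorem finrank_sup_points (n : ℕ) {P Q : PGPoint n F} (h : P ≠ Q) :
    Module.finrank F (P.1 ⊔ Q.1 : Submodule F (Fin (n + 1) → F)) = 2 := by
  have h1 := Submodule.finrank_sup_add_finrank_inf_eq P.1 Q.1
  rw [P.2, Q.2] at h1
  have h2 : Module.finrank F (P.1 ⊓ Q.1 : Submodule F (Fin (n + 1) → F)) ≠ 1 := by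
    intro h3
    apply h
    have h4 : P.1 ⊓ Q.1 = P.1 := Submodule.eq_of_le_of_finrank_eq inf_le_left (by rw [h3, P.2])
    have h5 : P.1 ⊓ Q.1 = Q.1 := Submodule.eq_of_le_of_finrank_eq inf_le_right (by rw [h3, Q.2])
    exact Subtype.ext (h4.symm.trans h5)
  have h6 : Module.finrank F (P.1 ⊓ Q.1 : Submodule F (Fin (n + 1) → F)) ≤ 1 :=
    (Submodule.finrank_mono inf_le_left).trans_eq P.2
  omega

theorem finrank_inf_hyperplanes (n : ℕ) {H K : PGHyperplane n F} (h : H ≠ K) :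
    Module.finrank F (H.1 ⊓ K.1 : Submodule F (Fin (n + 1) → F)) = n - 1 := by
  have h1 := Submodule.finrank_sup_add_finrank_inf_eq H.1 K.1
  rw [H.2, K.2] at h1
  have h2 : Module.finrank F (H.1 ⊔ K.1 : Submodule F (Fin (n + 1) → F)) ≠ n := by
    intro h3
    apply h
    have h4 : H.1 = H.1 ⊔ K.1 := Submodule.eq_of_le_of_finrank_eq le_sup_left (by rw [h3, H.2])
    have h5 : K.1 = H.1 ⊔ K.1 := Submodule.eq_of_le_of_finrank_eq le_sup_right (by rw [h3, K.2])
    exact Subtype.ext (h4.trans h5.symm)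
  have h6 : n ≤ Module.finrank F (H.1 ⊔ K.1 : Submodule F (Fin (n + 1) → F)) :=
    H.2.symm.trans_le (Submodule.finrank_mono le_sup_left)
  have h7 : Module.finrank F (H.1 ⊔ K.1 : Submodule F (Fin (n + 1) → F)) ≤ n + 1 := by
    simpa using Submodule.finrank_le (H.1 ⊔ K.1)
  omega

end Counting

/-! ### The real optimisation behind the lower bound on the boundary -/

/-- For `a ≤ b` the bound on `x` is zero exactly at `a + s = R`. Below this threshold use `0 ≤ x`,
above it add both bounds. Each case is worst at the threshold, where both reduce to `hstar`. -/
theorem add_excess_gt_of_add_eq {s v R ρ : ℝ} (hs : 0 < s) (hv : 0 < v) (hR : 0 < R)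
    (hR2 : R ^ 2 = s * (v + s)) (hstar : R * (v + 4 * s + ρ) < (2 * s + ρ) * (v + 2 * s))
    {a b x y : ℝ} (ha : 0 ≤ a) (hb : 0 ≤ b) (hab : a + b = v) (hx : 0 ≤ x) (hy : 0 ≤ y)
    (hxa : a * (v + s) / (a + s) - b ≤ x) (hyb : b * (v + s) / (b + s) - a ≤ y) :
    v - ρ < x + y := by
  wlog hle : a ≤ b generalizing a b x y
  · rw [add_comm x y]
    exact this hb ha (by linarith) hy hx hyb hxa (by linarith)
  have hf : ∀ c : ℝ, 0 ≤ c → c * (v + s) / (c + s) = v + s - R ^ 2 / (c + s) := by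
    intro c hc
    have : c + s ≠ 0 := by positivity
    rw [hR2]; field_simp; ring
  rw [hf a ha] at hxa
  rw [hf b hb] at hyb
  have hW : 0 < v + 2 * s - R := by
    have : R ^ 2 < (v + 2 * s) ^ 2 := by rw [hR2]; nlinarith
    have := lt_of_pow_lt_pow_left₀ 2 (by positivity) this
    linarith
  rcases le_total a (R - s) with h | h
  · have h1 : R ^ 2 / (b + s) ≤ R ^ 2 / (v + 2 * s - R) :=
      div_le_div_of_nonneg_left (by positivity) hW (by linarith)
    have h2 : R ^ 2 / (v + 2 * s - R) < 2 * s + ρ - R := by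
      rw [div_lt_iff₀ hW]; linarith
    linarith
  -- The two factors have fixed sum `v + 2 * s` and both are at least `R`, so their product is
  -- smallest when one of them equals `R`.
  · have h1 : R * (v + 2 * s - R) ≤ (a + s) * (b + s) := by
      have : b = v - a := by linarith
      subst this
      nlinarith [mul_nonneg (show 0 ≤ a + s - R by linarith) (show 0 ≤ v + s - a - R by linarith)]
    have h2 : R ^ 2 / (a + s) + R ^ 2 / (b + s) = R ^ 2 * (v + 2 * s) / ((a + s) * (b + s)) := by
      have : a + s ≠ 0 := by positivity
      have : b + s ≠ 0 := by positivity
      rw [← hab]; field_simp; ring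
    have h3 : R ^ 2 * (v + 2 * s) / ((a + s) * (b + s)) ≤
        R ^ 2 * (v + 2 * s) / (R * (v + 2 * s - R)) :=
      div_le_div_of_nonneg_left (by positivity) (by positivity) h1
    have h4 : R ^ 2 * (v + 2 * s) / (R * (v + 2 * s - R)) < 2 * s + ρ := by
      rw [div_lt_iff₀ (by positivity)]
      nlinarith
    linarith

/-- Scaling by `T = v / (a + b) ≥ 1` reduces to the case `a + b = v`: the function `c ↦ c * (v + s)
/ (c + s)` grows at most linearly under scaling up. -/
theorem add_excess_gt {s v R ρ : ℝ} (hs : 0 < s) (hv : 0 < v) (hR : 0 < R)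
    (hR2 : R ^ 2 = s * (v + s)) (hstar : R * (v + 4 * s + ρ) < (2 * s + ρ) * (v + 2 * s))
    {a b x y : ℝ} (ha : 0 ≤ a) (hb : 0 ≤ b) (hab0 : 0 < a + b) (hab : a + b ≤ v)
    (hx : 0 ≤ x) (hy : 0 ≤ y)
    (hxa : a * (v + s) / (a + s) - b ≤ x) (hyb : b * (v + s) / (b + s) - a ≤ y) :
    (a + b) * (1 - ρ / v) < x + y := by
  set T := v / (a + b) with hT
  have hT1 : 1 ≤ T := by rw [hT, le_div_iff₀ hab0]; linarith
  have hTv : T * (a + b) = v := by rw [hT]; field_simp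
  have hf : ∀ c : ℝ, 0 ≤ c → T * c * (v + s) / (T * c + s) ≤ T * (c * (v + s) / (c + s)) := by
    intro c hc
    rw [mul_assoc, mul_div_assoc]
    refine mul_le_mul_of_nonneg_left ?_ (by positivity)
    exact div_le_div_of_nonneg_left (by positivity) (by positivity) (by nlinarith)
  have key := add_excess_gt_of_add_eq hs hv hR hR2 hstar (a := T * a) (b := T * b) (x := T * x)
    (y := T * y) (by positivity) (by positivity) (by linarith) (by positivity) (by positivity)
    (by have := hf a ha; nlinarith) (by have := hf b hb; nlinarith)
  have h1 : (a + b) * (1 - ρ / v) = (v - ρ) / T := by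
    rw [hT]; field_simp
  rw [h1, div_lt_iff₀ (by positivity)]
  linarith

/-- In the application `l = q ^ ((n - 1) / 2)`, so `l < 2` happens only for the planes of order 2
and 3. At order 2 the expression is negative, which is why the Fano plane is treated apart. -/
theorem projective_parameter_bound {q μ l : ℝ} (hq : 2 ≤ q) (hμ : 1 ≤ μ) (hl : 0 < l)
    (hl2 : l ^ 2 = (q - 1) * μ + 1)
    (h : 2 ≤ l ∨ (q = 3 ∧ μ = 1)) :
    0 < (l - 1) * (q ^ 2 * μ + q + 1 + 4 * (l ^ 2 / μ)) + l - 2 * q * l ^ 2 := by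
  have hs : q - 1 ≤ l ^ 2 / μ := by rw [le_div_iff₀ (by positivity), hl2]; linarith
  have hl1 : 1 < l := by nlinarith
  rcases h with h | ⟨rfl, rfl⟩
  · have h1 : (q + 1) * (l ^ 2 - 1) ≤ q ^ 2 * μ := by rw [hl2]; nlinarith
    have h2 : (l - 1) * ((q + 1) * (l ^ 2 - 1) + q + 1 + 4 * (q - 1)) ≤
      (l - 1) * (q ^ 2 * μ + q + 1 + 4 * (l ^ 2 / μ)) :=
      mul_le_mul_of_nonneg_left (by linarith) (by linarith)
    -- After `h2` the lower bound is linear in `q`: `h3` is its `q`-part and `h4` its constant part.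
    have h3 : 0 ≤ q * ((l - 2) * (l ^ 2 - l + 2)) :=
      mul_nonneg (by linarith) (mul_nonneg (by linarith) (by nlinarith))
    have h4 : 0 < l ^ 3 - l ^ 2 - 3 * l + 4 := by
      nlinarith [mul_nonneg (show 0 ≤ l - 2 by linarith) (show 0 ≤ l - 2 by linarith),
        mul_nonneg (mul_nonneg (show 0 ≤ l - 2 by linarith) (show 0 ≤ l - 2 by linarith)) hl.le]
    nlinarith
  · have h3 : l ^ 2 = 3 := by linarith
    have h4 : 1.7 < l := by nlinarith
    rw [h3]; linarith

/-- This is `hstar` for `s = l ^ 2 / μ`, `R = l * k / μ`, `ρ = q * l`. The difference of the sides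
is `l / μ` times the quantity in `projective_parameter_bound`. -/
theorem projective_star {q μ k v l : ℝ} (hq : 2 ≤ q) (hμ : 1 ≤ μ) (hl : 0 < l)
    (hl2 : l ^ 2 = (q - 1) * μ + 1) (hk : k = q * μ + 1) (hv : v = q * k + 1)
    (h : 2 ≤ l ∨ (q = 3 ∧ μ = 1)) :
    l * k / μ * (v + 4 * (l ^ 2 / μ) + q * l) <
      (2 * (l ^ 2 / μ) + q * l) * (v + 2 * (l ^ 2 / μ)) := by
  have hE := projective_parameter_bound hq hμ hl hl2 h
  have hμ0 : 0 < μ := by linarith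
  have hE' := mul_pos (mul_pos hl hE) hμ0
  rw [← sub_pos]
  have : (2 * (l ^ 2 / μ) + q * l) * (v + 2 * (l ^ 2 / μ)) -
      l * k / μ * (v + 4 * (l ^ 2 / μ) + q * l) =
      l / μ * ((l - 1) * (q ^ 2 * μ + q + 1 + 4 * (l ^ 2 / μ)) + l - 2 * q * l ^ 2) := by
    have hμ1 : μ = (l ^ 2 - 1) / (q - 1) := by
      rw [eq_div_iff (by linarith)]; linarith
    have : q - 1 ≠ 0 := by linarith
    have : l ^ 2 - 1 ≠ 0 := by nlinarith
    rw [hv, hk, hμ1]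
    field_simp
    ring
  rw [this]
  positivity

/-- The lower bound for the size of the vertex boundary of a set with `a` points and `b`
hyperplanes in a projective space. -/
theorem boundary_gt {q μ k v l : ℝ} (hq : 2 ≤ q) (hμ : 1 ≤ μ) (hl : 0 < l)
    (hl2 : l ^ 2 = (q - 1) * μ + 1) (hk : k = q * μ + 1) (hv : v = q * k + 1)
    (h : 2 ≤ l ∨ (q = 3 ∧ μ = 1)) {a b x y A B : ℝ} (ha : 0 ≤ a) (hb : 0 ≤ b)
    (hab0 : 0 < a + b) (hab : a + b ≤ v) (hx : 0 ≤ x) (hy : 0 ≤ y)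
    (hA : a * k ^ 2 ≤ A * (k - μ + a * μ)) (hB : b * k ^ 2 ≤ B * (k - μ + b * μ))
    (hxa : A - b ≤ x) (hyb : B - a ≤ y) :
    (a + b) * (1 - q * l / v) < x + y := by
  have hμ0 : 0 < μ := by linarith
  have hk0 : 0 < k := by rw [hk]; positivity
  have hv0 : 0 < v := by rw [hv]; positivity
  have hl3 : k - μ = l ^ 2 := by rw [hl2, hk]; ring
  -- This identity turns the double counting bound into the shape `c * (v + s) / (c + s)`.
  have hvs : v + l ^ 2 / μ = k ^ 2 / μ := by
    rw [hv, hl2, hk]; field_simp; ring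
  have hf : ∀ c N : ℝ, 0 ≤ c → c * k ^ 2 ≤ N * (k - μ + c * μ) →
      c * (v + l ^ 2 / μ) / (c + l ^ 2 / μ) ≤ N := by
    intro c N hc hN
    rw [hvs, div_le_iff₀ (by positivity)]
    rw [hl3] at hN
    have h1 : N * (c + l ^ 2 / μ) = N * (l ^ 2 + c * μ) / μ := by field_simp; ring
    rw [h1, ← mul_div_assoc]
    gcongr
  refine add_excess_gt (s := l ^ 2 / μ) (R := l * k / μ) (by positivity) hv0 (by positivity) ?_
    (projective_star hq hμ hl hl2 hk hv h) ha hb hab0 hab hx hy ?_ ?_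
  · rw [hvs]; field_simp
  · linarith [hf a A ha hA]
  · linarith [hf b B hb hB]

/-- Here `k = 3` and `m = 1`. Integrality of `A` and `B` rescues the double counting bound where its
real version is too weak. -/
theorem fano_boundary {a b x y A B : ℕ} (hab0 : 0 < a + b) (hab : a + b ≤ 7)
    (hA : a * 9 ≤ A * (2 + a)) (hB : b * 9 ≤ B * (2 + b))
    (hx : A ≤ x + b) (hy : B ≤ y + a) : 3 * (a + b) ≤ 5 * (x + y) := by
  have ha : a ≤ 7 := by omega
  have hb : b ≤ 7 := by omega
  interval_cases a <;> interval_cases b <;> omega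

/-! ### The lower bound for the isoperimetric number -/

section Isoperimetry

theorem ncard_neighbours_lower_bound {α β : Type*} [Finite α] [Finite β]
    (r : α → β → Prop) (k m : ℕ) (A : Set α)
    (hk : ∀ a, Nat.card {b // r a b} = k)
    (hm : ∀ a a', a ≠ a' → Nat.card {b // r a b ∧ r a' b} = m) :
    (A.ncard : ℝ) * k ^ 2 ≤ ({b : β | ∃ a ∈ A, r a b}.ncard : ℝ) * ((k - m : ℝ) + A.ncard * m) := by
  classical
  have := Fintype.ofFinite α
  have := Fintype.ofFinite β
  have h := card_neighbours_lower_bound r k m A.toFinset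
    (fun a _ => by rw [← hk a, Nat.card_eq_fintype_card, Fintype.card_subtype])
    (fun a _ a' _ h => by rw [← hm a a' h, Nat.card_eq_fintype_card, Fintype.card_subtype])
  rw [Set.ncard_eq_toFinset_card', Set.ncard_eq_toFinset_card']
  convert h using 5
  ext b
  simp

theorem ncard_eq_inl_add_inr {α β : Type*} [Finite α] [Finite β] (X : Set (α ⊕ β)) :
    X.ncard = (Sum.inl ⁻¹' X).ncard + (Sum.inr ⁻¹' X).ncard := by
  conv_lhs => rw [← Set.image_preimage_inl_union_image_preimage_inr X]
  rw [Set.ncard_union_eq, Set.ncard_image_of_injective _ Sum.inl_injective,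
    Set.ncard_image_of_injective _ Sum.inr_injective]
  rw [Set.disjoint_left]
  rintro _ ⟨a, -, rfl⟩ ⟨b, -, h⟩
  cases h

variable {F : Type*} [Field F] [Finite F]

theorem card_points (n : ℕ) :
    Nat.card (PGPoint n F) * (Nat.card F - 1) + 1 = Nat.card F ^ (n + 1) := by
  have h := card_points_le n (⊤ : Submodule F (Fin (n + 1) → F))
  rw [finrank_top, Module.finrank_fin_fun] at h
  rw [← h, Nat.card_congr (Equiv.subtypeUnivEquiv fun P => le_top)]

theorem card_hyperplanes_eq_card_points (n : ℕ) (F : Type*) [Field F] :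
    Nat.card (PGHyperplane n F) = Nat.card (PGPoint n F) :=
  (Nat.card_congr (pointEquivHyperplane n F)).symm

/-- `A` and `B` count the neighbours of the points and of the hyperplanes of `X`; a neighbour is
either in `X` or in the boundary. By duality, points and hyperplanes have the same degree `k` and
codegree `m`. -/
theorem ncard_add_ncard_boundary (n : ℕ) (X : Set (PGPoint n F ⊕ PGHyperplane n F)) {k m : ℕ}
    (hk : k * (Nat.card F - 1) + 1 = Nat.card F ^ n)
    (hm : m * (Nat.card F - 1) + 1 = Nat.card F ^ (n - 1)) :
    ∃ a b x y A B : ℕ, X.ncard = a + b ∧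
      ((pointHyperplaneGraph n F).vertexBoundary X).ncard = x + y ∧
      (a : ℝ) * k ^ 2 ≤ A * (k - m + a * m) ∧ (b : ℝ) * k ^ 2 ≤ B * (k - m + b * m) ∧
      A ≤ x + b ∧ B ≤ y + a := by
  have hq : 0 < Nat.card F - 1 := by
    have := Finite.one_lt_card (α := F); omega
  have hk' : ∀ j, j * (Nat.card F - 1) + 1 = Nat.card F ^ n → j = k := fun j hj =>
    Nat.eq_of_mul_eq_mul_right hq (by omega)
  have hm' : ∀ j, j * (Nat.card F - 1) + 1 = Nat.card F ^ (n - 1) → j = m := fun j hj =>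
    Nat.eq_of_mul_eq_mul_right hq (by omega)
  set A := Sum.inl ⁻¹' X
  set B := Sum.inr ⁻¹' X
  refine ⟨A.ncard, B.ncard,
    (Sum.inr ⁻¹' ((pointHyperplaneGraph n F).vertexBoundary X)).ncard,
    (Sum.inl ⁻¹' ((pointHyperplaneGraph n F).vertexBoundary X)).ncard,
    {H : PGHyperplane n F | ∃ P ∈ A, P.1 ≤ H.1}.ncard,
    {P : PGPoint n F | ∃ H ∈ B, P.1 ≤ H.1}.ncard, ncard_eq_inl_add_inr X,
    by rw [ncard_eq_inl_add_inr, add_comm], ?_, ?_, ?_, ?_⟩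
  · refine ncard_neighbours_lower_bound (fun (P : PGPoint n F) (H : PGHyperplane n F) => P.1 ≤ H.1)
      k m A (fun P => hk' _ ?_) fun P Q h => hm' _ ?_
    · rw [card_hyperplanes_ge, P.2]; simp
    · simp_rw [← sup_le_iff]
      rw [card_hyperplanes_ge, finrank_sup_points n h]
      rfl
  · refine ncard_neighbours_lower_bound (fun (H : PGHyperplane n F) (P : PGPoint n F) => P.1 ≤ H.1)
      k m B (fun P => hk' _ ?_) fun P Q h => hm' _ ?_
    · rw [card_points_le, P.2]
    · simp_rw [← le_inf_iff]
      rw [card_points_le, finrank_inf_hyperplanes n h]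
  · refine (Set.ncard_le_ncard ?_ (Set.toFinite _)).trans (Set.ncard_union_le _ _)
    rintro H ⟨P, hP, h⟩
    by_cases hH : H ∈ B
    · exact Or.inr hH
    · exact Or.inl ⟨hH, Sum.inl P, hP, h⟩
  · refine (Set.ncard_le_ncard ?_ (Set.toFinite _)).trans (Set.ncard_union_le _ _)
    rintro P ⟨H, hH, h⟩
    by_cases hP : P ∈ A
    · exact Or.inr hP
    · exact Or.inl ⟨hP, Sum.inr H, hH, h⟩

theorem two_le_card_vertices (n : ℕ) :
    2 ≤ Nat.card (PGPoint n F ⊕ PGHyperplane n F) := by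
  rw [Nat.card_sum, card_hyperplanes_eq_card_points]
  have h := card_points (F := F) n
  have : Nat.card (PGPoint n F) ≠ 0 := by
    intro h0
    rw [h0] at h
    have h1 := Finite.one_lt_card (α := F)
    have := Nat.one_lt_pow (Nat.succ_ne_zero n) h1
    rw [zero_mul, zero_add] at h
    exact absurd h this.ne
  omega

theorem vertexIsoperimetricNumber_gt {n : ℕ} (hn : 2 ≤ n) :
    1 - (Nat.card F : ℝ) ^ (((n : ℝ) + 1) / 2) / Nat.card (PGPoint n F) <
      (pointHyperplaneGraph n F).vertexIsoperimetricNumber := by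
  obtain ⟨X, hX, hcard, hr⟩ :=
    (SimpleGraph.isLeast_vertexIsoperimetricNumber (pointHyperplaneGraph n F)
      (two_le_card_vertices n)).1
  rw [hr]
  have hX0 : 0 < X.ncard := hX.ncard_pos (Set.toFinite _)
  have hX0' : (0 : ℝ) < X.ncard := by exact_mod_cast hX0
  rw [Nat.card_sum, card_hyperplanes_eq_card_points] at hcard
  set v := Nat.card (PGPoint n F) with hv
  have hXv : (X.ncard : ℝ) ≤ v := by push_cast at hcard; linarith
  set q := Nat.card F with hq
  have hq2 : 2 ≤ q := Finite.one_lt_card (α := F)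
  have hvq : v * (q - 1) + 1 = q ^ (n + 1) := card_points n
  have hgeom : ∀ j : ℕ, (∑ i ∈ Finset.range j, q ^ i) * (q - 1) + 1 = q ^ j := by
    intro j
    have h1 : 1 ≤ q ^ j := Nat.one_le_pow _ _ (by omega)
    rw [Nat.geomSum_eq hq2, Nat.div_mul_cancel (Nat.sub_one_dvd_pow_sub_one q j)]
    omega
  obtain ⟨a, b, x, y, A, B, hab, hxy, hA, hB, hx, hy⟩ :=
    ncard_add_ncard_boundary n X (hgeom n) (hgeom (n - 1))
  rw [hxy, lt_div_iff₀ hX0', mul_comm, hab]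
  rw [hab] at hX0 hXv
  set k := ∑ i ∈ Finset.range n, q ^ i with hk
  set m := ∑ i ∈ Finset.range (n - 1), q ^ i with hm
  have hq0 : (0 : ℝ) < q := by positivity
  have hkm : k = q * m + 1 := by
    obtain ⟨j, rfl⟩ : ∃ j, n = j + 1 := ⟨n - 1, by omega⟩
    rw [hk, hm, geom_sum_succ]; rfl
  have hvk : v = q * k + 1 := by
    rw [hk, ← geom_sum_succ]
    exact Nat.eq_of_mul_eq_mul_right (show 0 < q - 1 by omega) (by
      have := hgeom (n + 1); omega)
  have hm1 : 1 ≤ m := by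
    obtain ⟨j, rfl⟩ : ∃ j, n = j + 2 := ⟨n - 2, by omega⟩
    rw [hm]
    simp [Finset.sum_range_succ']
  by_cases hfano : q = 2 ∧ n = 2
  · obtain ⟨h1, h2⟩ := hfano
    subst h2
    have hm2 : m = 1 := by simp [hm]
    have hk2 : k = 3 := by rw [hkm, h1, hm2]
    have hv2 : v = 7 := by rw [hvk, h1, hk2]
    rw [hk2, hm2] at hA hB
    rw [hv2] at hXv ⊢
    have h5 := fano_boundary hX0 (by exact_mod_cast hXv)
      (A := A) (B := B) (x := x) (y := y) (by
        have : (a : ℝ) * 9 ≤ A * (2 + a) := by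
          push_cast at hA; linarith
        exact_mod_cast this) (by
        have : (b : ℝ) * 9 ≤ B * (2 + b) := by
          push_cast at hB; linarith
        exact_mod_cast this) hx hy
    have h5' : (3 : ℝ) * (a + b) ≤ 5 * (x + y) := by exact_mod_cast h5
    -- `1 - 2.8 / 7` is exactly the ratio `3 / 5` from `fano_boundary`.
    have h6 : (2.8 : ℝ) < (q : ℝ) ^ ((((2 : ℕ) : ℝ) + 1) / 2) := by
      rw [h1, show (((2 : ℕ) : ℝ) + 1) / 2 = (3 : ℕ) * (1 / 2 : ℝ) by norm_num, Real.rpow_mul (by norm_num),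
        ← Real.sqrt_eq_rpow]
      apply Real.lt_sqrt_of_sq_lt
      norm_num
    have hX0' : (0 : ℝ) < (a + b : ℕ) := by exact_mod_cast hX0
    push_cast at *
    nlinarith
  · set l : ℝ := (q : ℝ) ^ (((n : ℝ) - 1) / 2) with hl
    have hl0 : 0 < l := by positivity
    have hl2 : l ^ 2 = (q : ℝ) ^ (n - 1) := by
      rw [hl, ← Real.rpow_natCast, ← Real.rpow_mul hq0.le, ← Real.rpow_natCast]
      congr 1
      rw [Nat.cast_sub (by omega)]
      push_cast
      ring
    have hql : (q : ℝ) ^ (((n : ℝ) + 1) / 2) = q * l := by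
      rw [hl, ← Real.rpow_one_add' hq0.le]
      · congr 1; ring
      · have : (2 : ℝ) ≤ n := by exact_mod_cast hn
        intro h; linarith
    rw [hql]
    have hgm := hgeom (n - 1)
    rw [← hm] at hgm
    have hgm' : (m : ℝ) * (q - 1) + 1 = (q : ℝ) ^ (n - 1) := by
      have : ((m * (q - 1) + 1 : ℕ) : ℝ) = ((q ^ (n - 1) : ℕ) : ℝ) := by rw [hgm]
      push_cast [Nat.cast_sub (show 1 ≤ q by omega)] at this
      exact this
    have hx' : (A : ℝ) ≤ x + b := by exact_mod_cast hx
    have hy' : (B : ℝ) ≤ y + a := by exact_mod_cast hy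
    have := boundary_gt (q := q) (μ := m) (k := k) (v := v) (l := l) (by exact_mod_cast hq2)
      (by exact_mod_cast hm1) hl0 (by rw [hl2]; linarith) (by exact_mod_cast hkm)
      (by exact_mod_cast hvk) ?_ (a := a) (b := b) (x := x) (y := y) (A := A) (B := B)
      (by positivity) (by positivity) (by exact_mod_cast hX0) (by exact_mod_cast hXv)
      (by positivity) (by positivity) hA hB (by linarith) (by linarith)
    · exact_mod_cast this
    · by_cases h3 : q = 3 ∧ n = 2
      · right
        refine ⟨by rw [h3.1]; norm_num, ?_⟩
        simp [hm, h3.2]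
      · left
        have h4 : 4 ≤ q ^ (n - 1) := by
          rcases Nat.lt_or_ge q 4 with h | h
          · have : 2 ≤ n - 1 := by
              have : q = 2 ∨ q = 3 := by omega
              omega
            calc 4 = 2 ^ 2 := by norm_num
              _ ≤ q ^ 2 := Nat.pow_le_pow_left hq2 2
              _ ≤ q ^ (n - 1) := Nat.pow_le_pow_right (by omega) this
          · exact h.trans (Nat.le_self_pow (by omega) q)
        have h4' : (4 : ℝ) ≤ l ^ 2 := by rw [hl2]; exact_mod_cast h4
        nlinarith

end Isoperimetry

/-! ### Incidence-free configurations and the upper bound -/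

section Construction

/-- There are `N` points and `N` hyperplanes of the affine space `F ^ (d + 1)`, no two of them
incident, with the hyperplanes not parallel to the last coordinate axis. -/
def HasIncidenceFree (F : Type*) [Field F] (d N : ℕ) : Prop :=
  ∃ A T : Finset ((Fin d → F) × F), A.card = N ∧ T.card = N ∧
    ∀ a ∈ A, ∀ t ∈ T, t.2 + a.1 ⬝ᵥ t.1 + a.2 ≠ 0

variable {F : Type*} [Field F]

theorem HasIncidenceFree.of_le {d N : ℕ} (A T : Finset ((Fin d → F) × F)) (hA : N ≤ A.card)
    (hT : N ≤ T.card) (h : ∀ a ∈ A, ∀ t ∈ T, t.2 + a.1 ⬝ᵥ t.1 + a.2 ≠ 0) :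
    HasIncidenceFree F d N := by
  obtain ⟨A', hA', hAc⟩ := Finset.exists_subset_card_eq hA
  obtain ⟨T', hT', hTc⟩ := Finset.exists_subset_card_eq hT
  exact ⟨A', T', hAc, hTc, fun a ha t ht => h a (hA' ha) t (hT' ht)⟩

/-- Prefix the points with `(z, 0)` and the hyperplanes with `(0, w)`, for free `z` and `w`: the dot
products do not change. -/
theorem HasIncidenceFree.add_two [Finite F] {d N : ℕ} (h : HasIncidenceFree F d N) :
    HasIncidenceFree F (d + 2) (N * Nat.card F) := by
  classical
  have := Fintype.ofFinite F
  obtain ⟨A, T, hA, hT, h⟩ := h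
  let f : ((Fin d → F) × F) × F → (Fin (d + 2) → F) × F := fun u =>
    (Matrix.vecCons u.2 (Matrix.vecCons 0 u.1.1), u.1.2)
  let g : ((Fin d → F) × F) × F → (Fin (d + 2) → F) × F := fun u =>
    (Matrix.vecCons 0 (Matrix.vecCons u.2 u.1.1), u.1.2)
  have hf : Function.Injective f := by
    rintro ⟨⟨x, s⟩, z⟩ ⟨⟨x', s'⟩, z'⟩ h
    simp only [f, Prod.mk.injEq] at h
    obtain ⟨h1, h2⟩ := h
    obtain ⟨h3, h4⟩ := Matrix.vecCons_inj.1 h1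
    obtain ⟨h5, h6⟩ := Matrix.vecCons_inj.1 h4
    simp [h2, h3, h6]
  have hg : Function.Injective g := by
    rintro ⟨⟨x, s⟩, z⟩ ⟨⟨x', s'⟩, z'⟩ h
    simp only [g, Prod.mk.injEq] at h
    obtain ⟨h1, h2⟩ := h
    obtain ⟨h3, h4⟩ := Matrix.vecCons_inj.1 h1
    obtain ⟨h5, h6⟩ := Matrix.vecCons_inj.1 h4
    simp [h2, h5, h6]
  refine ⟨(A ×ˢ Finset.univ).image f, (T ×ˢ Finset.univ).image g, ?_, ?_, ?_⟩
  · rw [Finset.card_image_of_injective _ hf, Finset.card_product, hA, Finset.card_univ,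
      Nat.card_eq_fintype_card]
  · rw [Finset.card_image_of_injective _ hg, Finset.card_product, hT, Finset.card_univ,
      Nat.card_eq_fintype_card]
  · intro a ha t ht
    obtain ⟨⟨⟨x, s⟩, z⟩, hu, rfl⟩ := Finset.mem_image.1 ha
    obtain ⟨⟨⟨m, b⟩, w⟩, hw, rfl⟩ := Finset.mem_image.1 ht
    have := h (x, s) (Finset.mem_product.1 hu).1 (m, b) (Finset.mem_product.1 hw).1
    simpa [f, g] using this

/-- Take any half `S` and let `T` be the negatives of its complement. -/
theorem exists_finset_half (K : Type*) [AddCommGroup K] [Finite K] :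
    ∃ S T : Finset K, Nat.card K / 2 ≤ S.card ∧ Nat.card K / 2 ≤ T.card ∧
      ∀ s ∈ S, ∀ t ∈ T, t + s ≠ 0 := by
  classical
  have := Fintype.ofFinite K
  obtain ⟨S, -, hS⟩ := Finset.exists_subset_card_eq (s := (Finset.univ : Finset K))
    (n := Nat.card K / 2) (by rw [Finset.card_univ, Nat.card_eq_fintype_card]; omega)
  refine ⟨S, Sᶜ.image (fun x => -x), hS.ge, ?_, ?_⟩
  · rw [Finset.card_image_of_injective _ neg_injective, Finset.card_compl, hS,
      Nat.card_eq_fintype_card]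
    omega
  · intro s hs t ht h
    obtain ⟨u, hu, rfl⟩ := Finset.mem_image.1 ht
    rw [neg_add_eq_zero] at h
    subst h
    exact Finset.mem_compl.1 hu hs

theorem hasIncidenceFree_zero [Finite F] : HasIncidenceFree F 0 (Nat.card F / 2) := by
  classical
  obtain ⟨S, T, hS, hT, h⟩ := exists_finset_half F
  have hinj : Function.Injective fun s : F => ((![] : Fin 0 → F), s) := fun a b h => by
    simpa using h
  refine HasIncidenceFree.of_le (S.image fun s => (![], s)) (T.image fun s => (![], s)) ?_ ?_ ?_
  · rwa [Finset.card_image_of_injective _ hinj]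
  · rwa [Finset.card_image_of_injective _ hinj]
  · intro a ha t ht
    obtain ⟨s, hs, rfl⟩ := Finset.mem_image.1 ha
    obtain ⟨t, ht', rfl⟩ := Finset.mem_image.1 ht
    simpa using h s hs t ht'

theorem HasIncidenceFree.add_two_mul [Finite F] {d N : ℕ} (h : HasIncidenceFree F d N) (j : ℕ) :
    HasIncidenceFree F (d + 2 * j) (N * Nat.card F ^ j) := by
  induction j with
  | zero => simpa using h
  | succ j ih =>
    have := ih.add_two
    rwa [mul_assoc, ← pow_succ] at this

/-- The point of projective space spanned by a nonzero vector. -/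
def pointOfVector {n : ℕ} (x : Fin (n + 1) → F) (hx : x ≠ 0) : PGPoint n F :=
  ⟨Submodule.span F {x}, finrank_span_singleton hx⟩

theorem pointOfVector_eq {n : ℕ} {x y : Fin (n + 1) → F} {hx : x ≠ 0} {hy : y ≠ 0}
    (h : pointOfVector x hx = pointOfVector y hy) {i : Fin (n + 1)} (hi : x i = 1) (hi' : y i = 1) :
    x = y := by
  have h1 : x ∈ Submodule.span F {y} := by
    have := congrArg Subtype.val h
    simp only [pointOfVector] at this
    rw [← this]
    exact Submodule.mem_span_singleton_self x
  obtain ⟨c, rfl⟩ := Submodule.mem_span_singleton.1 h1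
  have : c = 1 := by simpa [hi'] using hi
  simp [this]

theorem pointOfVector_le_iff {n : ℕ} {x y : Fin (n + 1) → F} (hx : x ≠ 0) (hy : y ≠ 0) :
    (pointOfVector x hx).1 ≤ (pointEquivHyperplane n F (pointOfVector y hy)).1 ↔ y ⬝ᵥ x = 0 := by
  rw [pointEquivHyperplane_coe]
  simp only [pointOfVector, Submodule.span_singleton_le_iff_mem,
    LinearMap.BilinForm.mem_orthogonal_iff]
  constructor
  · intro h
    exact h y (Submodule.mem_span_singleton_self y)
  · intro h z hz
    obtain ⟨c, rfl⟩ := Submodule.mem_span_singleton.1 hz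
    simp [dotForm_apply, h]

/-- The test set is `A` together with the hyperplanes outside `T`. No hyperplane of `T` meets `A`,
so its boundary consists of points outside `A` only. -/
theorem vertexIsoperimetricNumber_le_of_ncard [Finite F] {n N : ℕ} (A : Set (PGPoint n F))
    (T : Set (PGHyperplane n F)) (hA : A.ncard = N) (hT : T.ncard = N)
    (h : ∀ P ∈ A, ∀ H ∈ T, ¬ P.1 ≤ H.1) :
    (pointHyperplaneGraph n F).vertexIsoperimetricNumber ≤ 1 - (N : ℝ) / Nat.card (PGPoint n F) := by
  have hv := two_le_card_vertices (F := F) n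
  have hleast := SimpleGraph.isLeast_vertexIsoperimetricNumber (pointHyperplaneGraph n F) hv
  rw [Nat.card_sum, card_hyperplanes_eq_card_points] at hv
  set v := Nat.card (PGPoint n F) with hvdef
  have hTc : Tᶜ.ncard = v - N := by
    rw [Set.ncard_compl, card_hyperplanes_eq_card_points, hT]
  have hNv : N ≤ v := hA ▸ Set.ncard_le_card A
  set X : Set (PGPoint n F ⊕ PGHyperplane n F) := Sum.inl '' A ∪ Sum.inr '' Tᶜ with hX
  have hXc : X.ncard = v := by
    have h1 : Sum.inl ⁻¹' X = A := by ext; simp [hX]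
    have h2 : Sum.inr ⁻¹' X = Tᶜ := by ext; simp [hX]
    rw [ncard_eq_inl_add_inr, h1, h2, hA, hTc]
    omega
  have hN : ((pointHyperplaneGraph n F).vertexBoundary X).ncard ≤ v - N := by
    rw [← hA, hvdef, ← Set.ncard_compl, 
      ← Set.ncard_image_of_injective Aᶜ (Sum.inl_injective (β := PGHyperplane n F))]
    refine Set.ncard_le_ncard ?_ (Set.toFinite _)
    rintro (P | H) ⟨hx, u, hu, hadj⟩
    · exact ⟨P, fun hP => hx (Or.inl ⟨P, hP, rfl⟩), rfl⟩
    · exfalso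
      rcases hu with ⟨P, hP, rfl⟩ | ⟨K, hK, rfl⟩
      · have : H ∈ T := by
          by_contra hH
          exact hx (Or.inr ⟨H, hH, rfl⟩)
        exact h P hP H this hadj
      · exact hadj
  have hv0 : (0 : ℝ) < v := by
    have : 0 < v := by omega
    exact_mod_cast this
  refine (hleast.2 ⟨X, ?_, ?_, rfl⟩).trans ?_
  · rw [← Set.ncard_pos (Set.toFinite _), hXc]; omega
  · rw [hXc, Nat.card_sum, card_hyperplanes_eq_card_points]; push_cast; linarith
  · rw [hXc, div_le_iff₀ hv0, sub_mul, div_mul_cancel₀ _ hv0.ne', one_mul, ← Nat.cast_sub hNv]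
    exact_mod_cast hN

/-- Homogenise: a point `(x, s)` becomes `(1, s, x)` and a hyperplane `(m, b)` becomes `(b, 1, m)`,
with dot product `b + s + m ⬝ᵥ x`. The fixed entry `1` makes both maps to subspaces injective. -/
theorem HasIncidenceFree.vertexIsoperimetricNumber_le [Finite F] {d N : ℕ}
    (h : HasIncidenceFree F d N) :
    (pointHyperplaneGraph (d + 1) F).vertexIsoperimetricNumber ≤
      1 - (N : ℝ) / Nat.card (PGPoint (d + 1) F) := by
  obtain ⟨A, T, hA, hT, h⟩ := h
  let f : (Fin d → F) × F → Fin (d + 1 + 1) → F := fun u =>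
    Matrix.vecCons 1 (Matrix.vecCons u.2 u.1)
  let g : (Fin d → F) × F → Fin (d + 1 + 1) → F := fun u =>
    Matrix.vecCons u.2 (Matrix.vecCons 1 u.1)
  have hf1 : ∀ u, f u 0 = 1 := fun u => rfl
  have hg1 : ∀ u, g u 1 = 1 := fun u => rfl
  have hf0 : ∀ u, f u ≠ 0 := fun u h0 => by simpa [h0] using hf1 u
  have hg0 : ∀ u, g u ≠ 0 := fun u h0 => by simpa [h0] using hg1 u
  have hf : Function.Injective f := by
    rintro ⟨x, s⟩ ⟨x', s'⟩ h
    obtain ⟨h3, h4⟩ := Matrix.vecCons_inj.1 h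
    obtain ⟨h5, h6⟩ := Matrix.vecCons_inj.1 h4
    simp at h5 h6
    simp [h5, h6]
  have hg : Function.Injective g := by
    rintro ⟨x, s⟩ ⟨x', s'⟩ h
    obtain ⟨h3, h4⟩ := Matrix.vecCons_inj.1 h
    obtain ⟨h5, h6⟩ := Matrix.vecCons_inj.1 h4
    simp at h3 h6
    simp [h3, h6]
  refine vertexIsoperimetricNumber_le_of_ncard ((fun u => pointOfVector (f u) (hf0 u)) '' A)
    ((fun u => pointEquivHyperplane _ F (pointOfVector (g u) (hg0 u))) '' T) ?_ ?_ ?_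
  · rw [Set.ncard_image_of_injective, Set.ncard_coe_finset, hA]
    exact fun u u' huu => hf (pointOfVector_eq huu (hf1 u) (hf1 u'))
  · rw [Set.ncard_image_of_injective, Set.ncard_coe_finset, hT]
    exact fun u u' huu => hg (pointOfVector_eq ((pointEquivHyperplane _ F).injective huu)
      (hg1 u) (hg1 u'))
  · rintro _ ⟨a, ha, rfl⟩ _ ⟨t, ht, rfl⟩
    rw [pointOfVector_le_iff]
    have := h a ha t ht
    intro h0
    apply this
    rw [← h0]
    simp only [f, g, Matrix.cons_dotProduct_cons]
    rw [dotProduct_comm]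
    ring

end Construction

/-! ### From the prime field to its extensions -/

section Lifting

variable {F : Type*} [Field F]

theorem sum_smul_pow_injective {K : Type*} [Field K] [Algebra K F] {θ : F} {j N : ℕ} (hj : j ≤ N)
    (hθ : LinearIndependent K fun i : Fin (N + 1) => θ ^ (i : ℕ)) :
    Function.Injective fun a : Fin (j + 1) → K => ∑ i, a i • θ ^ (i : ℕ) := by
  have h := hθ.comp (Fin.castLE (Nat.succ_le_succ hj)) (Fin.castLE_injective _)
  intro a b hab
  have h2 := Fintype.linearIndependent_iff.1 h (a - b) (by
    simpa [sub_smul, sub_eq_zero] using hab)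
  ext i
  exact sub_eq_zero.1 (h2 i)

/-- Two polynomials in `θ` of degree at most `j` have a product of degree at most `2 * j ≤ N`, so no
reduction occurs; the coefficient of `θ ^ N` can only come from the two leading terms. -/
theorem coord_mul_sum_smul_pow {K : Type*} [Field K] [Algebra K F] {θ : F} {j N : ℕ}
    (hj : 2 * j ≤ N) {π : F →ₗ[K] K} (hπ : ∀ i ≤ N, π (θ ^ i) = if i = N then 1 else 0)
    (a b : Fin (j + 1) → K) :
    π ((∑ i, a i • θ ^ (i : ℕ)) * ∑ i, b i • θ ^ (i : ℕ)) =
      if N = 2 * j then a (Fin.last j) * b (Fin.last j) else 0 := by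
  rw [Finset.sum_mul_sum, map_sum]
  have h1 : ∀ i k : Fin (j + 1), π (a i • θ ^ (i : ℕ) * b k • θ ^ (k : ℕ)) =
      if (i : ℕ) + k = N then a i * b k else 0 := by
    intro i k
    rw [smul_mul_smul_comm, ← pow_add, map_smul, hπ _ (by have := i.2; have := k.2; omega)]
    simp
  simp_rw [map_sum, h1]
  split_ifs with hN
  · rw [Finset.sum_eq_single (Fin.last j), Finset.sum_eq_single (Fin.last j)]
    · rw [if_pos]; simp; omega
    · intro k _ hk
      rw [if_neg]
      have := Fin.val_lt_last hk
      simp; omega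
    · simp
    · intro i _ hi
      refine Finset.sum_eq_zero fun k _ => ?_
      rw [if_neg]
      have := Fin.val_lt_last hi
      have := k.2
      omega
    · simp
  · refine Finset.sum_eq_zero fun i _ => Finset.sum_eq_zero fun k _ => ?_
    rw [if_neg]
    have := i.2
    have := k.2
    omega

/-- Lifting an incidence-free configuration from a subfield along the top coefficients with
respect to a power basis. -/
theorem hasIncidenceFree_lift {K : Type*} [Field K] [Finite K] [Algebra K F] {θ : F} {j N M : ℕ}
    (hj : 2 * j ≤ N) (hθ : LinearIndependent K fun i : Fin (N + 1) => θ ^ (i : ℕ))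
    {π : F →ₗ[K] K} (hπ : ∀ i ≤ N, π (θ ^ i) = if i = N then 1 else 0)
    (A T : Finset (K × K)) (hA : M ≤ A.card) (hT : M ≤ T.card)
    (h : ∀ a ∈ A, ∀ t ∈ T, t.2 + (if N = 2 * j then a.1 * t.1 else 0) + a.2 ≠ 0) :
    HasIncidenceFree F 1 (M * Nat.card K ^ (j + N)) := by
  classical
  have := Fintype.ofFinite K
  let L : (n : ℕ) → (Fin n → K) → K → F := fun n f u =>
    ∑ i : Fin (n + 1), (Fin.snoc f u : Fin (n + 1) → K) i • θ ^ (i : ℕ)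
  have hL : ∀ n ≤ N, ∀ f f' u u', L n f u = L n f' u' → f = f' ∧ u = u' := fun n hn f f' u u' h =>
    Fin.snoc_inj.1 (sum_smul_pow_injective hn hθ h)
  have hLπ : ∀ f u, π (L N f u) = u := by
    intro f u
    simp only [L, map_sum, map_smul]
    rw [Finset.sum_eq_single (Fin.last N)]
    · rw [hπ _ (by simp)]; simp
    · intro i _ hi
      have := Fin.val_lt_last hi
      rw [hπ _ (by omega), if_neg (by omega)]; simp
    · simp
  -- Only the top coefficients come from the given pair: degree `j` for the first coordinate, degree
  -- `N` for the second. The `j + N` lower ones are free, which gives the factor `Nat.card K ^ (j +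
  -- N)`.
  let Φ : (K × K) × (Fin j → K) × (Fin N → K) → (Fin 1 → F) × F := fun u =>
    (![L j u.2.1 u.1.1], L N u.2.2 u.1.2)
  have hΦ : Function.Injective Φ := by
    rintro ⟨⟨x, z⟩, f, g⟩ ⟨⟨x', z'⟩, f', g'⟩ h
    simp only [Φ, Prod.mk.injEq] at h
    obtain ⟨h3, -⟩ := Matrix.vecCons_inj.1 h.1
    obtain ⟨rfl, rfl⟩ := hL j (by omega) _ _ _ _ h3
    obtain ⟨rfl, rfl⟩ := hL N le_rfl _ _ _ _ h.2
    rfl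
  have hcard : ∀ S : Finset (K × K), ((S ×ˢ Finset.univ).image Φ).card =
      S.card * Nat.card K ^ (j + N) := by
    intro S
    rw [Finset.card_image_of_injective _ hΦ, Finset.card_product, Finset.card_univ]
    simp [pow_add]
  refine HasIncidenceFree.of_le ((A ×ˢ Finset.univ).image Φ) ((T ×ˢ Finset.univ).image Φ)
    ?_ ?_ ?_
  · rw [hcard]; gcongr
  · rw [hcard]; gcongr
  · intro a ha t ht h0
    obtain ⟨⟨⟨x, z⟩, f, g⟩, hu, rfl⟩ := Finset.mem_image.1 ha
    obtain ⟨⟨⟨m, b⟩, f', g'⟩, hw, rfl⟩ := Finset.mem_image.1 ht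
    apply h (x, z) (Finset.mem_product.1 hu).1 (m, b) (Finset.mem_product.1 hw).1
    have h1 := congrArg π h0
    simp only [Φ, map_add, hLπ, map_zero] at h1
    have h2 : ![L j f x] ⬝ᵥ ![L j f' m] = L j f x * L j f' m := by simp
    rw [h2, coord_mul_sum_smul_pow hj hπ, Fin.snoc_last, Fin.snoc_last] at h1
    exact h1

theorem exists_coordinate_powers (K F : Type*) [Field K] [Field F] [Finite K] [Finite F]
    [Algebra K F] {N : ℕ} (hN : Module.finrank K F = N + 1) :
    ∃ (θ : F) (π : F →ₗ[K] K), LinearIndependent K (fun i : Fin (N + 1) => θ ^ (i : ℕ)) ∧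
      ∀ i ≤ N, π (θ ^ i) = if i = N then 1 else 0 := by
  let pb := Field.powerBasisOfFiniteOfSeparable K F
  have hdim : N + 1 = pb.dim := by rw [← hN, pb.finrank]
  let B := pb.basis.reindex (finCongr hdim.symm)
  have hB : ∀ i, B i = pb.gen ^ (i : ℕ) := fun i => by simp [B]
  refine ⟨pb.gen, B.coord (Fin.last N), ?_, ?_⟩
  · have := B.linearIndependent
    rwa [show (B : Fin (N + 1) → F) = fun i : Fin (N + 1) => pb.gen ^ (i : ℕ) from funext hB] at this
  · intro i hi
    have h := hB ⟨i, by omega⟩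
    simp only at h
    rw [← h, Module.Basis.coord_apply, Module.Basis.repr_self, Finsupp.single_apply]
    simp [Fin.ext_iff]

/-- Incidence-free configurations in affine planes of order `p ^ e`, given one over the prime
field. -/
theorem hasIncidenceFree_one {p e M : ℕ} [Fact p.Prime] [Finite F] (he : 1 ≤ e)
    (hF : Nat.card F = p ^ e) (A T : Finset (ZMod p × ZMod p)) (hA : M ≤ A.card) (hT : M ≤ T.card)
    (h : ∀ a ∈ A, ∀ t ∈ T, t.2 + a.1 * t.1 + a.2 ≠ 0) :
    (∃ j, e = 2 * j + 1 ∧ HasIncidenceFree F 1 (M * p ^ (3 * j))) ∨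
    (∃ j, e = 2 * j + 2 ∧ HasIncidenceFree F 1 (p / 2 * p ^ (3 * j + 2))) := by
  classical
  have hp : p.Prime := Fact.out
  have := Fintype.ofFinite F
  have hchar : CharP F p := by
    obtain ⟨r, hr⟩ := CharP.exists F
    have hrp : r.Prime := CharP.char_is_prime F r
    have := Fact.mk hrp
    obtain ⟨n, -, hn⟩ := FiniteField.card F r
    rw [← Nat.card_eq_fintype_card, hF] at hn
    have : p ∣ r ^ (n : ℕ) := hn ▸ dvd_pow_self p (by omega)
    rwa [(Nat.prime_dvd_prime_iff_eq hp hrp).1 (hp.dvd_of_dvd_pow this)]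
  let _ : Algebra (ZMod p) F := ZMod.algebra F p
  have hfr : Module.finrank (ZMod p) F = e := by
    have h1 := Module.natCard_eq_pow_finrank (K := ZMod p) (V := F)
    rw [hF, Nat.card_zmod] at h1
    exact (Nat.pow_right_injective hp.two_le h1).symm
  obtain ⟨N, rfl⟩ : ∃ N, e = N + 1 := ⟨e - 1, by omega⟩
  obtain ⟨θ, π, hθ, hπ⟩ := exists_coordinate_powers (ZMod p) F hfr
  -- For `N = 2 * j` the top coefficients satisfy the planar condition over `ZMod p`. For `N = 2 * j
  -- + 1` the product term disappears, so all first coordinates are allowed and the second ones need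
  -- only a half of `ZMod p`.
  rcases Nat.even_or_odd' N with ⟨j, rfl | rfl⟩
  · left
    refine ⟨j, rfl, ?_⟩
    have := hasIncidenceFree_lift (F := F) (j := j) le_rfl hθ hπ A T hA hT (by simpa using h)
    rw [Nat.card_zmod] at this
    convert this using 3
    ring
  · right
    refine ⟨j, rfl, ?_⟩
    obtain ⟨S, S', hS, hS', hSS⟩ := exists_finset_half (ZMod p)
    rw [Nat.card_zmod] at hS hS'
    have := hasIncidenceFree_lift (F := F) (j := j) (M := p * (p / 2)) (by omega) hθ hπ
      (Finset.univ ×ˢ S) (Finset.univ ×ˢ S')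
      (by rw [Finset.card_product, Finset.card_univ, ZMod.card]; gcongr)
      (by rw [Finset.card_product, Finset.card_univ, ZMod.card]; gcongr)
      (by
        intro a ha t ht
        rw [if_neg (by omega), add_zero]
        exact hSS _ (Finset.mem_product.1 ha).2 _ (Finset.mem_product.1 ht).2)
    rw [Nat.card_zmod] at this
    convert this using 1
    ring

end Lifting

/-! ### Volume and lattice points of the truncated light cone -/

section LightCone

open MeasureTheory Filter Topology
open scoped Pointwise

/-- The intersection of the open light cone with the open unit ball in `ℝ ^ 3`. -/
def lightConeBall : Set (Fin 3 → ℝ) :=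
  {x | 0 < x 0 ∧ x 1 ^ 2 + x 2 ^ 2 < x 0 ^ 2 ∧ x 0 ^ 2 + x 1 ^ 2 + x 2 ^ 2 < 1}

theorem abs_inner_lt_of_sq_lt {a b c a' b' c' : ℝ} (hc : 0 ≤ c) (hc' : 0 ≤ c')
    (h : a ^ 2 + b ^ 2 < c ^ 2) (h' : a' ^ 2 + b' ^ 2 < c' ^ 2) :
    |a * a' + b * b'| < c * c' := by
  refine abs_lt_of_sq_lt_sq ?_ (mul_nonneg hc hc')
  have h1 : (a ^ 2 + b ^ 2) * (a' ^ 2 + b' ^ 2) < c ^ 2 * c' ^ 2 :=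
    mul_lt_mul'' h h' (by positivity) (by positivity)
  nlinarith [sq_nonneg (a * b' - b * a')]

theorem inner_lt_of_sq_lt {a b c a' b' c' d : ℝ}
    (h : a ^ 2 + b ^ 2 + c ^ 2 < d) (h' : a' ^ 2 + b' ^ 2 + c' ^ 2 < d) :
    a * a' + b * b' + c * c' < d := by
  nlinarith [sq_nonneg (a - a'), sq_nonneg (b - b'), sq_nonneg (c - c')]

theorem convex_lightConeBall : Convex ℝ lightConeBall := by
  rw [convex_iff_forall_pos]
  rintro x ⟨hx0, hx1, hx2⟩ y ⟨hy0, hy1, hy2⟩ s t hs ht hst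
  have h1 := (le_abs_self _).trans_lt (abs_inner_lt_of_sq_lt hx0.le hy0.le hx1 hy1)
  have h2 := inner_lt_of_sq_lt hx2 hy2
  have hst0 : 0 < s * t := mul_pos hs ht
  refine ⟨?_, ?_, ?_⟩ <;> simp only [Pi.add_apply, Pi.smul_apply, smul_eq_mul]
  · positivity
  · nlinarith [mul_lt_mul_of_pos_left h1 hst0, mul_lt_mul_of_pos_left hx1 (mul_pos hs hs),
      mul_lt_mul_of_pos_left hy1 (mul_pos ht ht)]
  · have : (1 : ℝ) = s * s + 2 * (s * t) + t * t := by
      rw [← one_pow 2, ← hst]; ring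
    rw [this]
    nlinarith [mul_lt_mul_of_pos_left h2 hst0, mul_lt_mul_of_pos_left hx2 (mul_pos hs hs),
      mul_lt_mul_of_pos_left hy2 (mul_pos ht ht)]

theorem isOpen_lightConeBall : IsOpen lightConeBall := by
  have h1 : IsOpen {x : Fin 3 → ℝ | 0 < x 0} := isOpen_lt (by fun_prop) (by fun_prop)
  have h2 : IsOpen {x : Fin 3 → ℝ | x 1 ^ 2 + x 2 ^ 2 < x 0 ^ 2} :=
    isOpen_lt (by fun_prop) (by fun_prop)
  have h3 : IsOpen {x : Fin 3 → ℝ | x 0 ^ 2 + x 1 ^ 2 + x 2 ^ 2 < 1} :=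
    isOpen_lt (by fun_prop) (by fun_prop)
  exact h1.inter (h2.inter h3)

theorem isBounded_lightConeBall : Bornology.IsBounded lightConeBall := by
  refine (Metric.isBounded_closedBall (x := (0 : Fin 3 → ℝ)) (r := 1)).subset ?_
  rintro x ⟨-, -, h⟩
  rw [mem_closedBall_zero_iff, pi_norm_le_iff_of_nonneg zero_le_one]
  have h0 := sq_nonneg (x 0)
  have h1 := sq_nonneg (x 1)
  have h2 := sq_nonneg (x 2)
  intro i
  rw [Real.norm_eq_abs, ← sq_le_one_iff_abs_le_one]
  fin_cases i
  · show x 0 ^ 2 ≤ 1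
    linarith
  · show x 1 ^ 2 ≤ 1
    linarith
  · show x 2 ^ 2 ≤ 1
    linarith

theorem smul_lightConeBall_subset ⦃x y : ℝ⦄ (hx : 0 < x) (hxy : x ≤ y) :
    x • lightConeBall ⊆ y • lightConeBall := by
  have hy : 0 < y := hx.trans_le hxy
  rintro _ ⟨u, ⟨h0, h1, h2⟩, rfl⟩
  have hr : 0 < x / y := by positivity
  have hr1 : x / y ≤ 1 := (div_le_one hy).2 hxy
  refine ⟨(x / y) • u, ⟨?_, ?_, ?_⟩, ?_⟩
  · simp only [Pi.smul_apply, smul_eq_mul]; positivity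
  · simp only [Pi.smul_apply, smul_eq_mul, mul_pow, ← mul_add]
    gcongr
  · simp only [Pi.smul_apply, smul_eq_mul, mul_pow, ← mul_add]
    have : (x / y) ^ 2 ≤ 1 := pow_le_one₀ hr.le hr1
    nlinarith [sq_nonneg (u 0), sq_nonneg (u 1), sq_nonneg (u 2)]
  · simp only [smul_smul]
    rw [mul_div_cancel₀ _ hy.ne']

theorem volume_disc {c : ℝ} (hc : 0 ≤ c) :
    volume {w : Fin 2 → ℝ | w 0 ^ 2 + w 1 ^ 2 < c} = ENNReal.ofReal (c * Real.pi) := by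
  have h := EuclideanSpace.volume_ball_fin_two 0 √c
  rw [← (PiLp.volume_preserving_toLp (Fin 2)).measure_preimage
    measurableSet_ball.nullMeasurableSet] at h
  have h2 : {w : Fin 2 → ℝ | w 0 ^ 2 + w 1 ^ 2 < c} =
      WithLp.toLp 2 ⁻¹' Metric.ball (0 : EuclideanSpace ℝ (Fin 2)) √c := by
    ext w
    simp [EuclideanSpace.norm_eq, Real.sqrt_lt_sqrt_iff (show 0 ≤ w 0 ^ 2 + w 1 ^ 2 by positivity)]
  rw [h2, h, ← ENNReal.ofReal_pow (Real.sqrt_nonneg _), Real.sq_sqrt hc,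
    ENNReal.ofReal_mul hc]

/-- The slice at height `a` is a disc of squared radius `a ^ 2` up to `a = √2 / 2`, where cone and
sphere meet, and `1 - a ^ 2` from there to `1`. -/
theorem volume_lightConeBall_ge :
    2 * Real.pi / 3 * (1 - √2 / 2) ≤ volume.real lightConeBall := by
  have hfin : volume lightConeBall ≠ ⊤ := isBounded_lightConeBall.measure_lt_top.ne
  rw [Measure.real, ← ENNReal.ofReal_le_iff_le_toReal hfin]
  set c : ℝ := √2 / 2 with hc
  have hc2 : c ^ 2 = 1 / 2 := by rw [hc, div_pow, Real.sq_sqrt (by norm_num)]; norm_num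
  have hc0 : 0 < c := by positivity
  have hc8 : c < 4 / 5 := by nlinarith
  have hc1 : c < 1 := by linarith
  set S : Set (ℝ × (Fin 2 → ℝ)) :=
    {z | 0 < z.1 ∧ z.2 0 ^ 2 + z.2 1 ^ 2 < z.1 ^ 2 ∧ z.1 ^ 2 + z.2 0 ^ 2 + z.2 1 ^ 2 < 1} with hS
  have hSm : MeasurableSet S := by
    have h1 : IsOpen {z : ℝ × (Fin 2 → ℝ) | 0 < z.1} := isOpen_lt (by fun_prop) (by fun_prop)
    have h2 : IsOpen {z : ℝ × (Fin 2 → ℝ) | z.2 0 ^ 2 + z.2 1 ^ 2 < z.1 ^ 2} :=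
      isOpen_lt (by fun_prop) (by fun_prop)
    have h3 : IsOpen {z : ℝ × (Fin 2 → ℝ) | z.1 ^ 2 + z.2 0 ^ 2 + z.2 1 ^ 2 < 1} :=
      isOpen_lt (by fun_prop) (by fun_prop)
    exact (h1.inter (h2.inter h3)).measurableSet
  have hvol : volume lightConeBall = volume S := by
    rw [← (volume_preserving_piFinSuccAbove (fun _ : Fin 3 => ℝ) 0).measure_preimage
      hSm.nullMeasurableSet]
    rfl
  rw [hvol, Measure.volume_eq_prod, Measure.prod_apply hSm]
  have h1 : ∀ a ∈ Set.Ioc 0 c, volume (Prod.mk a ⁻¹' S) = ENNReal.ofReal (a ^ 2 * Real.pi) := by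
    rintro a ⟨ha0, ha⟩
    rw [← volume_disc (by positivity)]
    congr 1
    ext w
    simp only [hS, Set.mem_preimage, Set.mem_ofPred_eq]
    constructor
    · exact fun h => h.2.1
    · intro h
      refine ⟨ha0, h, ?_⟩
      nlinarith
  have h2 : ∀ a ∈ Set.Ioc c 1,
      volume (Prod.mk a ⁻¹' S) = ENNReal.ofReal ((1 - a ^ 2) * Real.pi) := by
    rintro a ⟨ha0, ha⟩
    rw [← volume_disc (by nlinarith)]
    congr 1
    ext w
    simp only [hS, Set.mem_preimage, Set.mem_ofPred_eq]
    constructor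
    · intro h
      linarith [h.2.2]
    · intro h
      refine ⟨by linarith, ?_, by linarith⟩
      nlinarith
  have i1 : ∫⁻ a in Set.Ioc 0 c, volume (Prod.mk a ⁻¹' S) =
      ENNReal.ofReal (c ^ 3 / 3 * Real.pi) := by
    rw [setLIntegral_congr_fun measurableSet_Ioc h1, ← ofReal_integral_eq_lintegral_ofReal]
    · rw [← intervalIntegral.integral_of_le hc0.le, intervalIntegral.integral_mul_const,
        integral_pow]
      norm_num
    · exact (Continuous.integrableOn_Ioc (by fun_prop))
    · exact ae_of_all _ fun a => by positivity
  have i2 : ∫⁻ a in Set.Ioc c 1, volume (Prod.mk a ⁻¹' S) =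
      ENNReal.ofReal (((1 - c) - (1 - c ^ 3) / 3) * Real.pi) := by
    rw [setLIntegral_congr_fun measurableSet_Ioc h2, ← ofReal_integral_eq_lintegral_ofReal]
    · rw [← intervalIntegral.integral_of_le hc1.le, intervalIntegral.integral_mul_const,
        intervalIntegral.integral_sub (by simp) (by
          exact (by fun_prop : Continuous fun a : ℝ => a ^ 2).intervalIntegrable _ _), integral_pow]
      norm_num
    · exact (Continuous.integrableOn_Ioc (by fun_prop))
    · refine (ae_restrict_iff' measurableSet_Ioc).2 (ae_of_all _ fun a ha => ?_)
      have := ha.1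
      have := ha.2
      have : 0 ≤ 1 - a ^ 2 := by nlinarith
      simp only [Pi.zero_apply]
      positivity
  have hc3 : c ^ 3 = c / 2 := by rw [pow_succ, hc2]; ring
  calc ENNReal.ofReal (2 * Real.pi / 3 * (1 - c))
      = ENNReal.ofReal (c ^ 3 / 3 * Real.pi) +
        ENNReal.ofReal (((1 - c) - (1 - c ^ 3) / 3) * Real.pi) := by
        rw [← ENNReal.ofReal_add (by positivity) (by
          rw [hc3]; exact mul_nonneg (by linarith) Real.pi_nonneg)]
        rw [hc3]; congr 1; ring
    _ = ∫⁻ a in Set.Ioc 0 c ∪ Set.Ioc c 1, volume (Prod.mk a ⁻¹' S) := by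
        rw [lintegral_union measurableSet_Ioc, i1, i2]
        exact Set.Ioc_disjoint_Ioc_of_le le_rfl
    _ ≤ ∫⁻ a, volume (Prod.mk a ⁻¹' S) := setLIntegral_le_lintegral _ _

/-- The integral points of the dilated set. -/
def lightConeLattice (t : ℝ) : Set (Fin 3 → ℤ) :=
  {x | 0 < x 0 ∧ x 1 ^ 2 + x 2 ^ 2 < x 0 ^ 2 ∧
    ((x 0 : ℝ) ^ 2 + (x 1 : ℝ) ^ 2 + (x 2 : ℝ) ^ 2 < t ^ 2)}

theorem mem_lightConeLattice_iff {t : ℝ} (ht : 0 < t) (x : Fin 3 → ℤ) :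
    x ∈ lightConeLattice t ↔ (t⁻¹ • fun i => (x i : ℝ)) ∈ lightConeBall := by
  have hti : 0 < t⁻¹ := by positivity
  simp only [lightConeLattice, lightConeBall, Set.mem_ofPred_eq, Pi.smul_apply, smul_eq_mul, mul_pow,
    ← mul_add, inv_pow]
  refine and_congr ?_ (and_congr ?_ ?_)
  · rw [mul_pos_iff_of_pos_left hti, Int.cast_pos]
  · rw [mul_lt_mul_iff_right₀ (by positivity)]
    exact_mod_cast Iff.rfl
  · rw [inv_mul_lt_iff₀ (by positivity), mul_one]

theorem tendsto_ncard_lightConeLattice :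
    Tendsto (fun t : ℝ => ((lightConeLattice t).ncard : ℝ) / t ^ 3) atTop
      (𝓝 (volume.real lightConeBall)) := by
  have h := tendsto_card_div_pow_atTop_volume' lightConeBall isBounded_lightConeBall
    isOpen_lightConeBall.measurableSet (convex_lightConeBall.addHaar_frontier volume)
    smul_lightConeBall_subset
  rw [Fintype.card_fin] at h
  refine h.congr' ?_
  filter_upwards [eventually_gt_atTop 0] with t ht
  congr 2
  symm
  rw [← Nat.card_coe_set_eq]
  refine Nat.card_congr (Equiv.ofBijective
    (fun x => ⟨t⁻¹ • fun i => (x.1 i : ℝ), (mem_lightConeLattice_iff ht _).1 x.2, ?_⟩) ⟨?_, ?_⟩)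
  · refine Set.smul_mem_smul_set ?_
    rw [SetLike.mem_coe, Module.Basis.mem_span_iff_repr_mem]
    intro i
    exact ⟨x.1 i, by simp⟩
  · intro x y hxy
    ext i
    have := congrFun (congrArg Subtype.val hxy) i
    simpa [ht.ne'] using this
  · rintro ⟨y, hy, z, hz, rfl⟩
    rw [SetLike.mem_coe, Module.Basis.mem_span_iff_repr_mem] at hz
    choose x hx using hz
    have hxz : (fun i => (x i : ℝ)) = z := funext fun i => by simpa using hx i
    refine ⟨⟨x, (mem_lightConeLattice_iff ht x).2 ?_⟩, ?_⟩
    · rw [hxz]; exact hy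
    · simp [hxz]

end LightCone

/-! ### Primitive vectors and the configuration over the prime field -/

section Primitive

open Filter Topology

theorem lightConeLattice_subset_Icc {t : ℝ} (ht : 0 ≤ t) :
    lightConeLattice t ⊆ Set.Icc ![1, -(⌊t⌋₊ : ℤ), -(⌊t⌋₊ : ℤ)]
      ![(⌊t⌋₊ : ℤ), (⌊t⌋₊ : ℤ), (⌊t⌋₊ : ℤ)] := by
  rintro x ⟨h0, -, h2⟩
  have hi : ∀ y : ℤ, (y : ℝ) ^ 2 ≤ t ^ 2 → |y| ≤ ⌊t⌋₊ := by
    intro y hy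
    rw [Int.natCast_floor_eq_floor ht, Int.le_floor, Int.cast_abs]
    exact abs_le_of_sq_le_sq hy ht
  have s0 := sq_nonneg (x 0 : ℝ)
  have s1 := sq_nonneg (x 1 : ℝ)
  have s2 := sq_nonneg (x 2 : ℝ)
  have a0 := abs_le.1 (hi (x 0) (by linarith))
  have a1 := abs_le.1 (hi (x 1) (by linarith))
  have a2 := abs_le.1 (hi (x 2) (by linarith))
  constructor <;> intro i <;> fin_cases i
  · exact h0
  · exact a1.1
  · exact a2.1
  · exact a0.2
  · exact a1.2
  · exact a2.2

theorem finite_lightConeLattice {t : ℝ} (ht : 0 ≤ t) : (lightConeLattice t).Finite :=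
  (Set.finite_Icc _ _).subset (lightConeLattice_subset_Icc ht)

theorem ncard_lightConeLattice_le {t : ℝ} (ht : 0 ≤ t) :
    ((lightConeLattice t).ncard : ℝ) ≤ 9 * t ^ 3 := by
  have h1 : (lightConeLattice t).ncard ≤ 9 * ⌊t⌋₊ ^ 3 := by
    refine (Set.ncard_le_ncard (lightConeLattice_subset_Icc ht) (Set.finite_Icc _ _)).trans ?_
    rw [← Finset.coe_Icc, Set.ncard_coe_finset, Pi.card_Icc, Fin.prod_univ_three]
    simp only [Int.card_Icc]
    set m := ⌊t⌋₊
    have e1 : ((m : ℤ) + 1 - 1).toNat = m := by omega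
    have e2 : ((m : ℤ) + 1 - -(m : ℤ)).toNat = 2 * m + 1 := by omega
    change ((m : ℤ) + 1 - 1).toNat * ((m : ℤ) + 1 - -(m : ℤ)).toNat *
      ((m : ℤ) + 1 - -(m : ℤ)).toNat ≤ _
    rw [e1, e2]
    rcases Nat.eq_zero_or_pos m with h | h
    · simp [h]
    · calc m * (2 * m + 1) * (2 * m + 1) ≤ m * (3 * m) * (3 * m) := by gcongr <;> omega
        _ = 9 * m ^ 3 := by ring
  calc ((lightConeLattice t).ncard : ℝ) ≤ ((9 * ⌊t⌋₊ ^ 3 : ℕ) : ℝ) := by exact_mod_cast h1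
    _ = 9 * (⌊t⌋₊ : ℝ) ^ 3 := by push_cast; ring
    _ ≤ 9 * t ^ 3 := by gcongr; exact Nat.floor_le ht

/-- The points of `lightConeLattice t` with coprime coordinates. -/
def primitiveLightConeLattice (t : ℝ) : Set (Fin 3 → ℤ) :=
  {x | x ∈ lightConeLattice t ∧ ∀ d : ℕ, d.Prime → ¬ ∀ i, (d : ℤ) ∣ x i}

theorem ncard_multiples_le {t : ℝ} (ht : 0 ≤ t) {d : ℕ} (hd : 0 < d) :
    {x | x ∈ lightConeLattice t ∧ ∀ i, (d : ℤ) ∣ x i}.ncard ≤ (lightConeLattice (t / d)).ncard := by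
  have hd0 : (0 : ℤ) < d := by exact_mod_cast hd
  have hd' : (0 : ℝ) < d := by exact_mod_cast hd
  refine (Set.ncard_le_ncard (t := (fun y i => (d : ℤ) * y i) '' lightConeLattice (t / d)) ?_
    ((finite_lightConeLattice (by positivity)).image _)).trans
    (Set.ncard_image_le (finite_lightConeLattice (by positivity)))
  rintro x ⟨⟨h0, h1, h2⟩, hx⟩
  choose y hy using hx
  obtain rfl : x = fun i => (d : ℤ) * y i := funext hy
  refine ⟨y, ⟨?_, ?_, ?_⟩, rfl⟩
  · exact (mul_pos_iff_of_pos_left hd0).1 h0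
  · simp only [mul_pow, ← mul_add] at h1
    exact lt_of_mul_lt_mul_left h1 (by positivity)
  · simp only [Int.cast_mul, Int.cast_natCast, mul_pow, ← mul_add] at h2
    rw [div_pow, lt_div_iff₀ (by positivity), mul_comm]
    exact h2

/-- Telescoping after replacing `m ^ 3` by `m * (m ^ 2 - 1)`; here `1860 = 2 * 31 * 30`. -/
theorem sum_inv_cube_le (m : ℕ) (hm : 31 ≤ m) :
    ∑ d ∈ Finset.Ico 31 m, ((d : ℝ) ^ 3)⁻¹ ≤ 1 / 1860 - 1 / (2 * m * (m - 1)) := by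
  induction m, hm using Nat.le_induction with
  | base => norm_num
  | succ m hm ih =>
    rw [Finset.sum_Ico_succ_top hm]
    have h : (31 : ℝ) ≤ m := by exact_mod_cast hm
    have key : ((m : ℝ) ^ 3)⁻¹ ≤ 1 / (2 * m * (m - 1)) - 1 / (2 * (m + 1) * m) := by
      have h1 : (m : ℝ) - 1 ≠ 0 := by linarith
      have h2 : 1 / (2 * m * ((m : ℝ) - 1)) - 1 / (2 * (m + 1) * m) = (m * (m ^ 2 - 1) : ℝ)⁻¹ := by
        have h3 : (m : ℝ) ^ 2 - 1 ≠ 0 := by nlinarith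
        field_simp
        ring
      rw [h2]
      apply inv_anti₀
      · apply mul_pos <;> nlinarith
      · nlinarith
    push_cast
    rw [show (m : ℝ) + 1 - 1 = m by ring]
    linarith

/-- A non-primitive vector is divisible by some prime. Primes below 31 keep their lattice counts, to
be evaluated asymptotically; all `d ≥ 31` together get the crude box bound `9 * (t / d) ^ 3`. This
union bound is all that is needed; no Möbius inversion enters. -/
theorem ncard_lightConeLattice_le_primitive {t : ℝ} (ht : 0 ≤ t) :
    ((lightConeLattice t).ncard : ℝ) ≤ (primitiveLightConeLattice t).ncard +
      ∑ d ∈ ({2, 3, 5, 7, 11, 13, 17, 19, 23, 29} : Finset ℕ),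
        ((lightConeLattice (t / d)).ncard : ℝ) + 9 / 1860 * t ^ 3 := by
  classical
  set D : Finset ℕ := {2, 3, 5, 7, 11, 13, 17, 19, 23, 29} with hD
  set M : ℕ → Set (Fin 3 → ℤ) := fun d => {x | x ∈ lightConeLattice t ∧ ∀ i, (d : ℤ) ∣ x i} with hM
  have hMfin : ∀ d, (M d).Finite := fun d => (finite_lightConeLattice ht).subset fun x hx => hx.1
  -- A divisor of `x 0 > 0` is at most `⌊t⌋₊`. The added `31` keeps the endpoint at least `31`, as
  -- `sum_inv_cube_le` requires.
  set E : Finset ℕ := Finset.Ico 31 (⌊t⌋₊ + 31) with hE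
  have hcover : lightConeLattice t ⊆ primitiveLightConeLattice t ∪
      ((⋃ d ∈ D, M d) ∪ ⋃ d ∈ E, M d) := by
    intro x hx
    by_cases hp : x ∈ primitiveLightConeLattice t
    · exact Or.inl hp
    right
    have : ∃ d : ℕ, d.Prime ∧ ∀ i, (d : ℤ) ∣ x i := by
      by_contra! h
      exact hp ⟨hx, fun d hd hdx => by
        obtain ⟨i, hi⟩ := h d hd
        exact hi (hdx i)⟩
    obtain ⟨d, hd, hdx⟩ := this
    rcases Nat.lt_or_ge d 31 with h | h
    · left
      have : d ∈ D := by
        rw [hD]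
        interval_cases d <;> first | decide | (exfalso; revert hd; norm_num)
      exact Set.mem_biUnion this ⟨hx, hdx⟩
    · right
      have h1 : (d : ℤ) ≤ x 0 := Int.le_of_dvd hx.1 (hdx 0)
      have h2 : x 0 ≤ ⌊t⌋₊ := (lightConeLattice_subset_Icc ht hx).2 0
      have : d ∈ E := by rw [hE, Finset.mem_Ico]; omega
      exact Set.mem_biUnion this ⟨hx, hdx⟩
  have hPfin : (primitiveLightConeLattice t).Finite :=
    (finite_lightConeLattice ht).subset fun x hx => hx.1
  have hU : ∀ S : Finset ℕ, (⋃ d ∈ S, M d).Finite ∧ (⋃ d ∈ S, M d).ncard ≤ ∑ d ∈ S, (M d).ncard := by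
    intro S
    induction S using Finset.induction_on with
    | empty => simp
    | insert a S ha ih =>
      rw [Finset.set_biUnion_insert, Finset.sum_insert ha]
      exact ⟨(hMfin a).union ih.1, (Set.ncard_union_le _ _).trans (by gcongr; exact ih.2)⟩
  have h1 : (lightConeLattice t).ncard ≤ (primitiveLightConeLattice t).ncard +
      (∑ d ∈ D, (M d).ncard + ∑ d ∈ E, (M d).ncard) := by
    refine (Set.ncard_le_ncard hcover (hPfin.union ((hU D).1.union (hU E).1))).trans ?_
    refine (Set.ncard_union_le _ _).trans ?_
    gcongr
    refine (Set.ncard_union_le _ _).trans ?_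
    exact add_le_add (hU D).2 (hU E).2
  have h2 : ∑ d ∈ D, ((M d).ncard : ℝ) ≤ ∑ d ∈ D, ((lightConeLattice (t / d)).ncard : ℝ) := by
    refine Finset.sum_le_sum fun d hd => ?_
    have : 0 < d := by
      rcases Nat.eq_zero_or_pos d with rfl | h
      · exact absurd hd (by decide)
      · exact h
    exact_mod_cast ncard_multiples_le ht this
  have h3 : ∑ d ∈ E, ((M d).ncard : ℝ) ≤ 9 / 1860 * t ^ 3 := by
    have : ∑ d ∈ E, ((M d).ncard : ℝ) ≤ ∑ d ∈ E, 9 * t ^ 3 * ((d : ℝ) ^ 3)⁻¹ := by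
      refine Finset.sum_le_sum fun d hd => ?_
      have hd0 : 0 < d := by
        have := (Finset.mem_Ico.1 hd).1
        omega
      refine (Nat.cast_le.2 (ncard_multiples_le ht hd0)).trans
        ((ncard_lightConeLattice_le (by positivity)).trans_eq ?_)
      rw [div_pow]; ring
    refine this.trans ?_
    rw [← Finset.mul_sum]
    have h4 := sum_inv_cube_le (⌊t⌋₊ + 31) (by omega)
    have h5 : (0 : ℝ) ≤ 1 / (2 * ((⌊t⌋₊ + 31 : ℕ) : ℝ) * (((⌊t⌋₊ + 31 : ℕ) : ℝ) - 1)) := by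
      have : (1 : ℝ) ≤ ((⌊t⌋₊ + 31 : ℕ) : ℝ) := by exact_mod_cast (by omega : 1 ≤ ⌊t⌋₊ + 31)
      have : (0 : ℝ) ≤ ((⌊t⌋₊ + 31 : ℕ) : ℝ) - 1 := by linarith
      positivity
    calc 9 * t ^ 3 * ∑ d ∈ E, ((d : ℝ) ^ 3)⁻¹ ≤ 9 * t ^ 3 * (1 / 1860) := by
          gcongr
          linarith
      _ = _ := by ring
  have h1' : ((lightConeLattice t).ncard : ℝ) ≤ (primitiveLightConeLattice t).ncard +
      (∑ d ∈ D, ((M d).ncard : ℝ) + ∑ d ∈ E, ((M d).ncard : ℝ)) := by exact_mod_cast h1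
  linarith

theorem eventually_primitive_ge :
    ∀ᶠ t : ℝ in atTop, t ^ 3 / 2 ≤ ((primitiveLightConeLattice t).ncard : ℝ) := by
  set V := MeasureTheory.volume.real lightConeBall with hV
  have hlim : Tendsto (fun t : ℝ => ((lightConeLattice t).ncard : ℝ) / t ^ 3 -
      ∑ d ∈ ({2, 3, 5, 7, 11, 13, 17, 19, 23, 29} : Finset ℕ),
        ((lightConeLattice (t / d)).ncard : ℝ) / t ^ 3) atTop
      (𝓝 (V - ∑ d ∈ ({2, 3, 5, 7, 11, 13, 17, 19, 23, 29} : Finset ℕ), V * ((d : ℝ) ^ 3)⁻¹)) := by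
    refine tendsto_ncard_lightConeLattice.sub (tendsto_finsetSum _ fun d hd => ?_)
    have hd0 : 0 < d := by
      rcases Nat.eq_zero_or_pos d with rfl | h
      · exact absurd hd (by decide)
      · exact h
    have hd' : (0 : ℝ) < d := by exact_mod_cast hd0
    refine ((tendsto_ncard_lightConeLattice.comp
      (tendsto_id.atTop_div_const hd')).mul_const (((d : ℝ) ^ 3)⁻¹)).congr fun t => ?_
    simp only [Function.comp_apply, id]
    field_simp
  have hVge : 0.6133 ≤ V := by
    refine le_trans ?_ volume_lightConeBall_ge
    have h1 := Real.pi_gt_d6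
    have h2 : √2 < 1.41422 := by
      rw [Real.sqrt_lt' (by norm_num)]; norm_num
    have h3 : (0.29289 : ℝ) ≤ 1 - √2 / 2 := by linarith
    calc (0.6133 : ℝ) ≤ 2 * 3.141592 / 3 * 0.29289 := by norm_num
      _ ≤ 2 * Real.pi / 3 * (1 - √2 / 2) := by gcongr
  -- The margin is thin: `0.6133 * (1 - 0.17464) ≈ 0.5062` against `0.5048`.
  have hgt : 1 / 2 + 9 / 1860 <
      V - ∑ d ∈ ({2, 3, 5, 7, 11, 13, 17, 19, 23, 29} : Finset ℕ), V * ((d : ℝ) ^ 3)⁻¹ := by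
    rw [← Finset.mul_sum]
    have : ∑ d ∈ ({2, 3, 5, 7, 11, 13, 17, 19, 23, 29} : Finset ℕ), ((d : ℝ) ^ 3)⁻¹ ≤ 0.17464 := by
      simp
      norm_num
    nlinarith
  filter_upwards [hlim.eventually (lt_mem_nhds hgt), eventually_gt_atTop 0] with t h1 ht
  have h2 := ncard_lightConeLattice_le_primitive ht.le
  rw [← Finset.sum_div, ← sub_div, lt_div_iff₀ (by positivity)] at h1
  linarith

theorem exists_bezout_of_primitive {x : Fin 3 → ℤ}
    (hx : ∀ d : ℕ, d.Prime → ¬ ∀ i, (d : ℤ) ∣ x i) : ∃ u : Fin 3 → ℤ, ∑ i, u i * x i = 1 := by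
  have hg : IsCoprime (Int.gcd (x 0) (x 1) : ℤ) (x 2) := by
    rw [Int.isCoprime_iff_gcd_eq_one]
    by_contra h
    obtain ⟨d, hd, hdvd⟩ := Nat.exists_prime_and_dvd h
    have h1 : (d : ℤ) ∣ Int.gcd (x 0) (x 1) := (Int.natCast_dvd_natCast.2 hdvd).trans
      (Int.gcd_dvd_left _ _)
    have h2 : (d : ℤ) ∣ x 2 := (Int.natCast_dvd_natCast.2 hdvd).trans (Int.gcd_dvd_right _ _)
    refine hx d hd fun i => ?_
    fin_cases i
    · exact h1.trans (Int.gcd_dvd_left _ _)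
    · exact h1.trans (Int.gcd_dvd_right _ _)
    · exact h2
  obtain ⟨a, b, hab⟩ := hg
  rw [Int.gcd_eq_gcd_ab] at hab
  refine ⟨![a * Int.gcdA (x 0) (x 1), a * Int.gcdB (x 0) (x 1), b], ?_⟩
  rw [Fin.sum_univ_three, ← hab]
  simp
  ring

/-- A Bézout relation for `x` makes the proportionality factor an integer `c`; a prime factor of `c`
would divide every coordinate of `y`. -/
theorem eq_of_primitive_of_proportional {x y : Fin 3 → ℤ}
    (hx : ∀ d : ℕ, d.Prime → ¬ ∀ i, (d : ℤ) ∣ x i) (hy : ∀ d : ℕ, d.Prime → ¬ ∀ i, (d : ℤ) ∣ y i)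
    (hx0 : 0 < x 0) (hy0 : 0 < y 0) (h : ∀ i j, x i * y j = x j * y i) : x = y := by
  obtain ⟨u, hu⟩ := exists_bezout_of_primitive hx
  set c := ∑ i, u i * y i with hc
  have hyc : ∀ j, y j = c * x j := by
    intro j
    calc y j = (∑ i, u i * x i) * y j := by rw [hu, one_mul]
      _ = ∑ i, u i * y i * x j := by
        rw [Finset.sum_mul]
        refine Finset.sum_congr rfl fun i _ => ?_
        rw [mul_assoc, h i j]; ring
      _ = c * x j := by rw [← Finset.sum_mul]
  have hc0 : 0 < c := by
    have := hyc 0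
    rw [this] at hy0
    exact (pos_iff_pos_of_mul_pos hy0).2 hx0
  have hc1 : c = 1 := by
    by_contra hne
    obtain ⟨d, hd, hdvd⟩ := Nat.exists_prime_and_dvd (n := c.natAbs) (by omega)
    exact hy d hd fun j => by
      rw [hyc j]
      exact Dvd.dvd.mul_right (Int.natCast_dvd.2 hdvd) _
  ext j
  rw [hyc j, hc1, one_mul]

/-- With `f` below, clearing denominators in the incidence expression leaves `x₀y₀ + x₁y₁ - x₂y₂`.
The cone makes this positive and the ball makes it less than `p`, both by Cauchy–Schwarz-type
bounds, so it is nonzero mod `p`. -/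
theorem exists_primeField_configuration {p : ℕ} [Fact p.Prime] :
    ∃ A : Finset (ZMod p × ZMod p), A.card = (primitiveLightConeLattice √p).ncard ∧
      ∀ a ∈ A, ∀ b ∈ A, 1 + b.2 + a.1 * b.1 + a.2 ≠ 0 := by
  classical
  have hp : p.Prime := Fact.out
  have hp2 : (2 : ℝ) ≤ p := by exact_mod_cast hp.two_le
  have hsq : √(p : ℝ) ^ 2 = p := Real.sq_sqrt (by positivity)
  have hfin : (primitiveLightConeLattice √p).Finite :=
    (finite_lightConeLattice (Real.sqrt_nonneg _)).subset fun x hx => hx.1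
  let f : (Fin 3 → ℤ) → ZMod p × ZMod p := fun x =>
    ((x 1 : ZMod p) / ((x 0 - x 2 : ℤ) : ZMod p), (x 2 : ZMod p) / ((x 0 - x 2 : ℤ) : ZMod p))
  have hne : ∀ z : ℤ, z ≠ 0 → |(z : ℝ)| < p → (z : ZMod p) ≠ 0 := by
    intro z hz hlt h
    refine hz (Int.eq_zero_of_abs_lt_dvd ((ZMod.intCast_zmod_eq_zero_iff_dvd z p).1 h) ?_)
    exact_mod_cast hlt
  have hcone : ∀ x ∈ lightConeLattice √p,
      0 < (x 0 : ℝ) ∧ (x 1 : ℝ) ^ 2 + (x 2 : ℝ) ^ 2 < (x 0 : ℝ) ^ 2 ∧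
      (x 0 : ℝ) ^ 2 + (x 1 : ℝ) ^ 2 + (x 2 : ℝ) ^ 2 < p := by
    rintro x ⟨h0, h1, h2⟩
    rw [hsq] at h2
    exact ⟨by exact_mod_cast h0, by exact_mod_cast h1, h2⟩
  have hD : ∀ x ∈ lightConeLattice √p, ((x 0 - x 2 : ℤ) : ZMod p) ≠ 0 := by
    intro x hx
    obtain ⟨h0, h1, h2⟩ := hcone x hx
    have h3 : |(x 2 : ℝ)| < x 0 := abs_lt_of_sq_lt_sq (by nlinarith) h0.le
    have h4 := (abs_lt.1 h3).2
    apply hne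
    · have : x 2 < x 0 := by exact_mod_cast h4
      omega
    · push_cast
      refine abs_lt_of_sq_lt_sq ?_ (by positivity)
      nlinarith [sq_nonneg ((x 0 : ℝ) + x 2)]
  -- The 2 by 2 minors are smaller than `p` in absolute value, so proportionality mod `p` is
  -- proportionality over the integers. For primitive vectors this forces equality, hence
  -- injectivity of `f`.
  have hcross : ∀ x ∈ lightConeLattice √p, ∀ y ∈ lightConeLattice √p, ∀ i j,
      (((x i * y j - x j * y i : ℤ)) : ZMod p) = 0 → x i * y j = x j * y i := by
    intro x hx y hy i j h
    rcases eq_or_ne i j with rfl | hij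
    · rfl
    have hle : ∀ z ∈ lightConeLattice √p, (z i : ℝ) ^ 2 + (z j : ℝ) ^ 2 < √(p : ℝ) ^ 2 := by
      intro z hz
      rw [hsq]
      obtain ⟨-, -, h2⟩ := hcone z hz
      refine lt_of_le_of_lt ?_ h2
      have s0 := sq_nonneg (z 0 : ℝ)
      have s1 := sq_nonneg (z 1 : ℝ)
      have s2 := sq_nonneg (z 2 : ℝ)
      fin_cases i <;> fin_cases j <;> first | (exact absurd rfl hij) | (simp; linarith)
    by_contra hne0
    refine hne _ (sub_ne_zero.2 hne0) ?_ h
    have h5 := abs_inner_lt_of_sq_lt (a := (x i : ℝ)) (b := x j) (a' := y j) (b' := -(y i : ℝ))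
      (Real.sqrt_nonneg _) (Real.sqrt_nonneg _) (hle x hx)
      (by have := hle y hy; rw [neg_sq]; linarith)
    rw [← pow_two, hsq] at h5
    push_cast
    convert h5 using 2
    ring
  have hinj : Set.InjOn f (primitiveLightConeLattice √p) := by
    rintro x ⟨hx, hxp⟩ y ⟨hy, hyp⟩ hxy
    have hDx := hD x hx
    have hDy := hD y hy
    simp only [f, Prod.mk.injEq] at hxy
    obtain ⟨e1, e2⟩ := hxy
    rw [div_eq_div_iff hDx hDy] at e1 e2
    push_cast at e1 e2 hDx hDy
    have c02 : (x 0 : ZMod p) * y 2 = x 2 * y 0 := by linear_combination -e2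
    have c01 : (x 0 : ZMod p) * y 1 = x 1 * y 0 := by
      have e3 : ((x 0 : ZMod p) - x 2) * ((x 0 : ZMod p) * y 1 - x 1 * y 0) = 0 := by
        linear_combination (-(x 0 : ZMod p)) * e1 + (x 1 : ZMod p) * e2
      rcases mul_eq_zero.1 e3 with h | h
      · exact absurd h hDx
      · exact sub_eq_zero.1 h
    have c12 : (x 1 : ZMod p) * y 2 = x 2 * y 1 := by
      linear_combination -e1 - c01
    refine eq_of_primitive_of_proportional hxp hyp hx.1 hy.1 fun i j => hcross x hx y hy i j ?_
    push_cast
    fin_cases i <;> fin_cases j <;> simp only [Fin.zero_eta, Fin.mk_one, Fin.reduceFinMk]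
    · ring
    · linear_combination c01
    · linear_combination c02
    · linear_combination -c01
    · ring
    · linear_combination c12
    · linear_combination -c02
    · linear_combination -c12
    · ring
  refine ⟨hfin.toFinset.image f, ?_, ?_⟩
  · rw [Finset.card_image_of_injOn (by simpa using hinj), Set.ncard_eq_toFinset_card _ hfin]
  · intro a ha b hb h
    obtain ⟨x, hx, rfl⟩ := Finset.mem_image.1 ha
    obtain ⟨y, hy, rfl⟩ := Finset.mem_image.1 hb
    have hx := ((hfin.mem_toFinset).1 hx).1
    have hy := ((hfin.mem_toFinset).1 hy).1
    have hDx := hD x hx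
    have hDy := hD y hy
    obtain ⟨x0, x1, x2⟩ := hcone x hx
    obtain ⟨y0, y1, y2⟩ := hcone y hy
    have h1 : ((x 0 * y 0 + x 1 * y 1 - x 2 * y 2 : ℤ) : ZMod p) = 0 := by
      simp only [f] at h
      push_cast at h hDx hDy ⊢
      field_simp at h
      linear_combination h
    have h2 := abs_lt.1 (abs_inner_lt_of_sq_lt (a' := (y 1 : ℝ)) (b' := -(y 2 : ℝ)) x0.le y0.le x1
      (by rw [neg_sq]; exact y1))
    have h3 := inner_lt_of_sq_lt (a' := (y 0 : ℝ)) (b' := (y 1 : ℝ)) (c' := -(y 2 : ℝ)) x2 (by rw [neg_sq]; exact y2)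
    refine hne _ ?_ ?_ h1
    · have : (0 : ℝ) < ((x 0 * y 0 + x 1 * y 1 - x 2 * y 2 : ℤ) : ℝ) := by
        push_cast; linarith [h2.1]
      exact_mod_cast this.ne'
    · push_cast
      rw [abs_lt]
      constructor <;> linarith [h2.1]

end Primitive

/-! ### Assembly of the two bounds -/

theorem rpow_three_halves_eq {x : ℝ} (hx : 0 ≤ x) : √x ^ 3 = x ^ (3 / 2 : ℝ) := by
  rw [Real.sqrt_eq_rpow, ← Real.rpow_natCast, ← Real.rpow_mul hx]
  norm_num

theorem exists_hasIncidenceFree_one {F : Type*} [Field F] [Finite F] {p e : ℕ} [Fact p.Prime]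
    (he : 1 ≤ e) (hF : Nat.card F = p ^ e)
    (hprim : √(p : ℝ) ^ 3 / 2 ≤ ((primitiveLightConeLattice √p).ncard : ℝ)) :
    ∃ N : ℕ, HasIncidenceFree F 1 N ∧
      (1 / 2 - 1 / (p : ℝ)) * (Nat.card F : ℝ) ^ (3 / 2 : ℝ) ≤ N := by
  classical
  have hp : p.Prime := Fact.out
  have hp0 : (0 : ℝ) < p := by exact_mod_cast hp.pos
  obtain ⟨A, hA, h⟩ := exists_primeField_configuration (p := p)
  have hinj : Function.Injective fun a : ZMod p × ZMod p => (a.1, 1 + a.2) := by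
    rintro ⟨a, b⟩ ⟨c, d⟩ h
    simpa using h
  have hpow : ∀ j : ℕ, ((p ^ j : ℕ) : ℝ) ^ (3 / 2 : ℝ) = (p : ℝ) ^ ((j : ℝ) * (3 / 2)) := by
    intro j
    rw [Nat.cast_pow, ← Real.rpow_natCast, ← Real.rpow_mul hp0.le]
  rcases hasIncidenceFree_one he hF A (A.image fun a => (a.1, 1 + a.2)) le_rfl
    (by rw [Finset.card_image_of_injective _ hinj]) (by
      intro a ha t ht
      obtain ⟨b, hb, rfl⟩ := Finset.mem_image.1 ht
      exact h a ha b hb) with ⟨j, rfl, hj⟩ | ⟨j, rfl, hj⟩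
  · refine ⟨_, hj, ?_⟩
    rw [hF, hpow, hA]
    have e1 : (p : ℝ) ^ (((2 * j + 1 : ℕ) : ℝ) * (3 / 2)) = √(p : ℝ) ^ 3 * (p : ℝ) ^ (3 * j) := by
      rw [rpow_three_halves_eq hp0.le, ← Real.rpow_natCast, ← Real.rpow_add hp0]
      congr 1
      push_cast
      ring
    rw [e1]
    push_cast
    calc (1 / 2 - 1 / (p : ℝ)) * (√(p : ℝ) ^ 3 * (p : ℝ) ^ (3 * j))
        ≤ (1 / 2) * (√(p : ℝ) ^ 3 * (p : ℝ) ^ (3 * j)) := by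
          gcongr
          have : (0 : ℝ) ≤ 1 / p := by positivity
          linarith
      _ = √(p : ℝ) ^ 3 / 2 * (p : ℝ) ^ (3 * j) := by ring
      _ ≤ _ := by gcongr
  · refine ⟨_, hj, ?_⟩
    rw [hF, hpow]
    have e1 : (p : ℝ) ^ (((2 * j + 2 : ℕ) : ℝ) * (3 / 2)) = p * (p : ℝ) ^ (3 * j + 2) := by
      rw [← pow_succ', ← Real.rpow_natCast]
      congr 1
      push_cast
      ring
    have h2 : (p : ℝ) ≤ 2 * ((p / 2 : ℕ) : ℝ) + 1 := by exact_mod_cast (by omega : p ≤ 2 * (p / 2) + 1)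
    rw [e1, ← mul_assoc, Nat.cast_mul, Nat.cast_pow]
    gcongr
    rw [sub_mul, div_mul_cancel₀ _ hp0.ne']
    linarith

/-- Even `d` grows from the affine line and odd `d` from the affine plane; each step `d ↦ d + 2`
multiplies both `N` and the target by the field size. -/
theorem exists_hasIncidenceFree {F : Type*} [Field F] [Finite F] {p e : ℕ} [Fact p.Prime]
    (he : 1 ≤ e) (hF : Nat.card F = p ^ e)
    (hprim : √(p : ℝ) ^ 3 / 2 ≤ ((primitiveLightConeLattice √p).ncard : ℝ)) (d : ℕ) :
    ∃ N : ℕ, HasIncidenceFree F d N ∧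
      (1 / 2 - 1 / (p : ℝ)) * (Nat.card F : ℝ) ^ (((d : ℝ) + 2) / 2) ≤ N := by
  have hp : p.Prime := Fact.out
  have hp0 : (0 : ℝ) < p := by exact_mod_cast hp.pos
  have hq0 : (0 : ℝ) < Nat.card F := by exact_mod_cast Nat.card_pos
  have hpq : (p : ℝ) ≤ Nat.card F := by
    rw [hF]; exact_mod_cast Nat.le_self_pow (by omega) p
  rcases Nat.even_or_odd' d with ⟨j, rfl | rfl⟩
  · have h := (hasIncidenceFree_zero (F := F)).add_two_mul j
    rw [zero_add] at h
    refine ⟨_, h, ?_⟩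
    have e1 : (Nat.card F : ℝ) ^ ((((2 * j : ℕ) : ℝ) + 2) / 2) =
        Nat.card F * (Nat.card F : ℝ) ^ j := by
      rw [← pow_succ', ← Real.rpow_natCast]
      congr 1
      push_cast
      ring
    have h2 : (Nat.card F : ℝ) ≤ 2 * ((Nat.card F / 2 : ℕ) : ℝ) + 1 := by
      exact_mod_cast (by omega : Nat.card F ≤ 2 * (Nat.card F / 2) + 1)
    rw [e1, ← mul_assoc, Nat.cast_mul, Nat.cast_pow]
    gcongr
    have h3 : 1 ≤ 1 / (p : ℝ) * Nat.card F := by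
      rw [one_div, inv_mul_eq_div, le_div_iff₀ hp0]; linarith
    rw [sub_mul]
    linarith
  · obtain ⟨N, hN, hle⟩ := exists_hasIncidenceFree_one he hF hprim
    have h := hN.add_two_mul j
    rw [add_comm 1] at h
    refine ⟨_, h, ?_⟩
    have e1 : (Nat.card F : ℝ) ^ ((((2 * j + 1 : ℕ) : ℝ) + 2) / 2) =
        (Nat.card F : ℝ) ^ (3 / 2 : ℝ) * (Nat.card F : ℝ) ^ j := by
      rw [← Real.rpow_natCast, ← Real.rpow_add hq0]
      congr 1
      push_cast
      ring
    rw [e1, ← mul_assoc, Nat.cast_mul, Nat.cast_pow]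
    gcongr

theorem exists_isoperimetric_constant {F : Type*} [Field F] [Finite F] {d N : ℕ} (hd : 1 ≤ d)
    (h : HasIncidenceFree F d N) {κ : ℝ}
    (hκ : κ * (Nat.card F : ℝ) ^ (((d : ℝ) + 2) / 2) ≤ N) :
    ∃ c : ℝ, (pointHyperplaneGraph (d + 1) F).vertexIsoperimetricNumber =
        1 - c * ((Nat.card F : ℝ) ^ ((((d + 1 : ℕ) : ℝ) + 1) / 2) * ((Nat.card F : ℝ) - 1) /
          ((Nat.card F : ℝ) ^ (d + 1 + 1) - 1)) ∧ κ ≤ c ∧ c < 1 := by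
  have h1 := vertexIsoperimetricNumber_gt (F := F) (n := d + 1) (by omega)
  have h2 := h.vertexIsoperimetricNumber_le
  have h3 := card_points (F := F) (d + 1)
  have hq : 1 < Nat.card F := Finite.one_lt_card
  have hq1 : (1 : ℝ) < Nat.card F := by exact_mod_cast hq
  rw [show ((d : ℝ) + 2) / 2 = (((d + 1 : ℕ) : ℝ) + 1) / 2 by push_cast; ring] at hκ
  set i := (pointHyperplaneGraph (d + 1) F).vertexIsoperimetricNumber
  set q := Nat.card F
  set v := Nat.card (PGPoint (d + 1) F)
  set ρ := (q : ℝ) ^ ((((d + 1 : ℕ) : ℝ) + 1) / 2) with hρ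
  have hρ0 : 0 < ρ := by positivity
  have h4 : (v : ℝ) * (q - 1) = (q : ℝ) ^ (d + 1 + 1) - 1 := by
    have : ((v * (q - 1) + 1 : ℕ) : ℝ) = ((q ^ (d + 1 + 1) : ℕ) : ℝ) := by rw [h3]
    push_cast [Nat.cast_sub hq.le] at this
    linarith
  have hv0 : (0 : ℝ) < v := by
    have h5 : (1 : ℝ) < (q : ℝ) ^ (d + 1 + 1) := one_lt_pow₀ hq1 (by omega)
    rw [← sub_pos, ← h4] at h5
    exact (pos_iff_pos_of_mul_pos h5).2 (by linarith)
  have h5 : ρ * ((q : ℝ) - 1) / ((q : ℝ) ^ (d + 1 + 1) - 1) = ρ / v := by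
    rw [← h4, mul_div_mul_right _ _ (by linarith)]
  rw [h5]
  refine ⟨(1 - i) / (ρ / v), ?_, ?_, ?_⟩
  · rw [div_mul_cancel₀ _ (by positivity)]; ring
  · rw [le_div_iff₀ (by positivity)]
    calc κ * (ρ / v) = κ * ρ / v := by ring
      _ ≤ N / v := by gcongr
      _ ≤ 1 - i := by linarith
  · rw [div_lt_one (by positivity)]
    linarith

theorem theorem1 (ε : ℝ) (hε₀ : 0 < ε) (hε₁ : ε < 1 / 4) :
    ∃ C : ℝ, 0 < C ∧
      ∀ (n p e q : ℕ), 2 ≤ n → p.Prime → 1 ≤ e → q = p ^ e →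
        ∀ (F : Type*) [Field F] [Finite F], Nat.card F = q →
          ∃ c : ℝ,
            (pointHyperplaneGraph n F).vertexIsoperimetricNumber =
              1 - c * ((q : ℝ) ^ (((n : ℝ) + 1) / 2) * ((q : ℝ) - 1) / ((q : ℝ) ^ (n + 1) - 1)) ∧
            1 / 2 - C * (p : ℝ) ^ (ε - 1 / 4) ≤ c ∧ c < 1 := by
  obtain ⟨t₀, ht₀⟩ := Filter.eventually_atTop.1 eventually_primitive_ge
  -- For `p < P` the choice `C = P ^ (1 / 4)` makes the lower bound on `c` nonpositive, so the empty
  -- configuration suffices. For `p ≥ P` the density estimate applies at `√p ≥ t₀`, and the loss `1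
  -- / p` is below `p ^ (ε - 1 / 4)`.
  set P : ℝ := max 1 (t₀ ^ 2) with hP
  have hP1 : 1 ≤ P := le_max_left _ _
  have hC1 : 1 ≤ P ^ (1 / 4 : ℝ) := Real.one_le_rpow hP1 (by norm_num)
  refine ⟨P ^ (1 / 4 : ℝ), by positivity, ?_⟩
  rintro n p e q hn hp he hq F _ _ rfl
  obtain ⟨d, rfl⟩ : ∃ d, n = d + 1 := ⟨n - 1, by omega⟩
  have := Fact.mk hp
  have hp1 : (1 : ℝ) ≤ p := by exact_mod_cast hp.one_le
  have hp0 : (0 : ℝ) < p := by linarith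
  have key : ∃ (N : ℕ) (κ : ℝ), HasIncidenceFree F d N ∧
      κ * (Nat.card F : ℝ) ^ (((d : ℝ) + 2) / 2) ≤ N ∧
      1 / 2 - P ^ (1 / 4 : ℝ) * (p : ℝ) ^ (ε - 1 / 4) ≤ κ := by
    rcases lt_or_ge (p : ℝ) P with h | h
    · refine ⟨0, 0, ⟨∅, ∅, by simp⟩, by simp, ?_⟩
      have h1 : (p : ℝ) ^ (-(1 / 4) : ℝ) ≤ (p : ℝ) ^ (ε - 1 / 4) :=
        Real.rpow_le_rpow_of_exponent_le hp1 (by linarith)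
      have h2 : (p : ℝ) ^ (1 / 4 : ℝ) ≤ P ^ (1 / 4 : ℝ) :=
        Real.rpow_le_rpow hp0.le h.le (by norm_num)
      have h3 : (p : ℝ) ^ (1 / 4 : ℝ) * (p : ℝ) ^ (-(1 / 4) : ℝ) = 1 := by
        rw [← Real.rpow_add hp0]; simp
      have h4 : 1 ≤ P ^ (1 / 4 : ℝ) * (p : ℝ) ^ (ε - 1 / 4) :=
        h3.symm.trans_le (mul_le_mul h2 h1 (by positivity) (by positivity))
      linarith
    · have ht : t₀ ≤ √p := Real.le_sqrt_of_sq_le ((le_max_right _ _).trans h)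
      obtain ⟨N, hN, hle⟩ := exists_hasIncidenceFree he hq (ht₀ _ ht) d
      refine ⟨N, _, hN, hle, ?_⟩
      have h1 : (p : ℝ) ^ (-1 : ℝ) ≤ (p : ℝ) ^ (ε - 1 / 4) :=
        Real.rpow_le_rpow_of_exponent_le hp1 (by linarith)
      rw [Real.rpow_neg_one] at h1
      have h2 : 1 * (p : ℝ) ^ (ε - 1 / 4) ≤ P ^ (1 / 4 : ℝ) * (p : ℝ) ^ (ε - 1 / 4) := by gcongr
      rw [one_div (p : ℝ)]
      linarith
  obtain ⟨N, κ, hN, hle, hκ⟩ := key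
  obtain ⟨c, hc, hκc, hc1⟩ := exists_isoperimetric_constant (by omega) hN hle
  exact ⟨c, hc, hκ.trans hκc, hc1⟩
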